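/- Let $n\ge 1$, let $\mathcal B=(1-\Delta)^{-1}$ be the Bessel potential operator on $\mathbb R^n$, and let $\sigma\in J_n^+=\{s\ge 0: s(s+n-2)\ge 0\}$. Let $\Lambda:[0,\infty)\to[0,\infty)$ be continuous with $\Lambda(t)>0$ for $t>0$, put $\Lambda_*(t)=\int_0^t\Lambda(s)\,ds$, and let $V\ge 0$ be a continuous function on $\mathbb R^n\times(0,\infty)$ such that, for some constants $\underline\vartheta,\overline\vartheta>0$, $$V(x,t)\ge\underline\vartheta\Lambda(t)|x|^\sigma\ (|x|\ge1,\ t>0),\qquad V(x,t)\le\overline\vartheta\Lambda(t)|x|^\sigma\ (x\in\mathbb R^n,\ t>0).$$ For $d\ge0$ and $\varepsilon_0>0$ consider the estimate $$\mathcal B\big(V(\cdot,t)|\cdot|^d\big)(x)\ \ge\ \varepsilon_0\,\underline\vartheta\,\Lambda(t)\,|x|^{\sigma+d}\qquad(x\in\mathbb R^n,\ t>0).\tag{E$_d$}$$ For $a\ge 0$ let $BC_a$ be the space of $\varphi\in C(\mathbb R^n)$ with $\varphi(x)=O(|x|^a)$ as $|x|\to\infty$, normed by $\sup_x(1+|x|^2)^{-a/2}|\varphi(x)|$.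 For $0<p<1$, an s-solution (in $C([0,\infty);BC_a)$) of the problem $$\partial_tu-\Delta\partial_tu=\Delta u+V(x,t)u^p\ \ (x\in\mathbb R^n,\ t>0),\qquad u(\cdot,0)=0,\tag{P}$$ is a function $0\le u\in C([0,\infty);BC_a)$ such that $\mu=e^tu$ satisfies $$\mu(x,t)=\int_0^t\mathcal B\mu(x,\tau)\,d\tau+\int_0^te^{(1-p)\tau}\mathcal B(V\mu^p)(x,\tau)\,d\tau\qquad(x\in\mathbb R^n,\ t\ge 0).$$ It is called maximal if $v\le u$ on $\mathbb R^n\times[0,\infty)$ for every s-solution $0\le v\in C([0,\infty);BC_a)$ of (P). Then: 1. There is a constant $\varepsilon_0>0$ such that (E$_d$) holds for all $d\ge0$. 2. Let $\varepsilon_0>0$, $0<p<1$ and $a\in\mathbb R$ be such that (E$_d$) holds for all $0\le d\le \frac{\sigma p}{1-p}$, and $$p<\varepsilon_0\,\frac{\underline\vartheta}{\overline\vartheta},\qquad a\ge\frac{\sigma}{1-p}.$$ Then problem (P) has a unique maximal s-solution $u_{*V}\in C([0,\infty);BC_a)$; in particular every s-solution of (P) in $C([0,\infty);BC_a)$ lies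 below $u_{*V}$. Moreover $$u_{*V}(x,t)\ge\big(\varepsilon_0\,\underline\vartheta\,(1-p)\,|x|^\sigma\Lambda_*(t)\big)^{\frac1{1-p}}\qquad(x\in\mathbb R^n,\ t\ge0).$$ -/

import Mathlib

open Filter Topology Asymptotics MeasureTheory

noncomputable section

namespace Pseudoparabolic

/-- The space `ℝⁿ` with its Euclidean norm. -/
abbrev Space (n : ℕ) : Type := EuclideanSpace ℝ (Fin n)

/-- The Bessel potential kernel, i.e. the convolution kernel of `(1 - Δ)⁻¹` on `ℝⁿ`
(Fourier symbol `1 / (1 + |ξ|²)`, total mass `1`), as the Laplace transform at `1` of the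
Gauss-Weierstrass heat kernel:
`B(x) = ∫₀^∞ e^{-s} (4πs)^{-n/2} e^{-|x|²/(4s)} ds = (2π)^{-n/2} |x|^{(2-n)/2} K_{(n-2)/2}(|x|)`.
For `n ≥ 2` the kernel is infinite at the single point `x = 0`, which is a null set for the
convolutions below. -/
def besselKernel (n : ℕ) (x : Space n) : ℝ :=
  ∫ s in Set.Ioi (0 : ℝ),
    Real.exp (-s) * (4 * Real.pi * s) ^ (-(n : ℝ) / 2) * Real.exp (-(‖x‖ ^ 2) / (4 * s))

/-- The Bessel potential operator `𝓑 φ = (1 - Δ)⁻¹ φ = B ∗ φ`. -/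
def besselPotential {n : ℕ} (φ : Space n → ℝ) (x : Space n) : ℝ :=
  ∫ y, besselKernel n (x - y) * φ y

/-- The exponent set `J_n⁺ = {s ≥ 0 : s (s + n - 2) ≥ 0}`, which is `{0} ∪ [1, ∞)` for `n = 1`
and `[0, ∞)` for `n ≥ 2`. -/
def JPlus (n : ℕ) : Set ℝ := {s | 0 ≤ s ∧ 0 ≤ s * (s + (n : ℝ) - 2)}

/-- `BC_a`: continuous functions with `|φ(x)| ≤ const · |x|^a` as `|x| → ∞`. -/
def BC (n : ℕ) (a : ℝ) : Set (Space n → ℝ) :=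
  {φ | Continuous φ ∧ φ =O[cocompact (Space n)] fun x => ‖x‖ ^ a}

/-- The weighted norm `‖φ‖_{R,a} = sup_x (R² + |x|²)^{-a/2} |φ(x)|`, for `φ ∈ BC_a`. -/
def weightedNorm {n : ℕ} (R a : ℝ) (φ : Space n → ℝ) : ℝ :=
  ⨆ x, (R ^ 2 + ‖x‖ ^ 2) ^ (-a / 2) * |φ x|

/-- `𝓩_{∞,a} = C([0,∞); BC_a)`. The norms `‖·‖_{R,a}`, `R > 0`, are equivalent on `BC_a`;
`R = 1` is used. Only the values at times `t ≥ 0` matter. -/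
def ZInfty (n : ℕ) (a : ℝ) : Set (Space n → ℝ → ℝ) :=
  {u | (∀ t, 0 ≤ t → (fun x => u x t) ∈ BC n a) ∧
    ∀ t, 0 ≤ t →
      Tendsto (fun s => weightedNorm 1 a fun x => u x s - u x t) (𝓝[Set.Ici 0] t) (𝓝 0)}

/-- The operator
`𝓜ˢ_{(u₀,V)} μ = u₀ + ∫₀ᵗ 𝓑 μ(τ) dτ + ∫₀ᵗ e^{(1-p)τ} 𝓑[V μ^p](τ) dτ`. -/
def Ms {n : ℕ} (p : ℝ) (u₀ : Space n → ℝ) (V : Space n → ℝ → ℝ) (μ : Space n → ℝ → ℝ)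
    (x : Space n) (t : ℝ) : ℝ :=
  u₀ x + (∫ τ in (0 : ℝ)..t, besselPotential (fun y => μ y τ) x)
    + ∫ τ in (0 : ℝ)..t,
        Real.exp ((1 - p) * τ) * besselPotential (fun y => V y τ * μ y τ ^ p) x

/-- `u ∈ 𝓩_{∞,a}`, `u ≥ 0`, is a global s-solution of
`∂ₜu - Δ∂ₜu = Δu + V u^p`, `u(·,0) = u₀`: the function `μ = eᵗ u` satisfies
`μ = 𝓜ˢ_{(u₀,V)} μ` on `ℝⁿ × [0,∞)`. -/
structure IsSSolution {n : ℕ} (p a : ℝ) (u₀ : Space n → ℝ) (V : Space n → ℝ → ℝ)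
    (u : Space n → ℝ → ℝ) : Prop where
  mem : u ∈ ZInfty n a
  nonneg : ∀ x t, 0 ≤ t → 0 ≤ u x t
  eq : ∀ x t, 0 ≤ t → Real.exp t * u x t = Ms p u₀ V (fun y s => Real.exp s * u y s) x t

/-- A maximal s-solution of the problem with zero initial data: an s-solution in `𝓩_{∞,a}`
which dominates every s-solution in `𝓩_{∞,a}` on `ℝⁿ × [0,∞)`. -/
structure IsMaximalSSolution {n : ℕ} (p a : ℝ) (V : Space n → ℝ → ℝ)
    (u : Space n → ℝ → ℝ) : Prop where
  isSSolution : IsSSolution p a (fun _ => 0) V u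
  le : ∀ v, IsSSolution p a (fun _ => 0) V v → ∀ x t, 0 ≤ t → v x t ≤ u x t

/-- The lower estimate `𝓑(V |·|^d) ≥ ε₀ ϑ Λ(t) |x|^{σ+d}` for `x ∈ ℝⁿ`, `t > 0`. -/
def BesselLowerEstimate {n : ℕ} (σ ϑ : ℝ) (L : ℝ → ℝ) (V : Space n → ℝ → ℝ) (ε₀ d : ℝ) : Prop :=
  ∀ x t, 0 < t →
    ε₀ * (ϑ * L t) * ‖x‖ ^ (σ + d) ≤ besselPotential (fun y => V y t * ‖y‖ ^ d) x

end Pseudoparabolic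

end

/-! Write 𝓑 as averaging over translates by a probability measure, `besselMeasure`, with a radial
density and finite polynomial moments. Then 𝓑 preserves order and maps the weight w_a =
(1+|x|²)^{a/2} below K·w_a (`besselPotential_weight_le`).

The first claim uses the symmetry of this measure: at least half of its mass in {|z| ≥ 2} lies where
⟨x,z⟩ ≤ 0. There |x-z| ≥ max(1,|x|), so the lower bound on V applies. This half-mass serves as ε₀
for every d.

For the second claim, u ↦ u^p is not Lipschitz at 0, so the maximal solution is built by order
arguments. The condition a ≥ σ/(1-p) says exactly that V·w_a^p grows no faster than w_a. Choose M(t)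
with a large enough exponential rate. Since (AM)^p ≤ AM for A ≥ 1, the fixed point operator sends
A·M·w_a below (A/2)·M·w_a (`Ms_le_barrier`). Halving A repeatedly brings every subsolution of
polynomial growth below M·w_a (`le_barrier_of_le_Ms`). Iterating the monotone operator from M·w_a
gives a decreasing sequence that stays above all such subsolutions. Its limit is a fixed point by
dominated convergence (`iterateLimit_eq_Ms`), hence maximal. The limit is continuous because 𝓑 turns
measurable functions of polynomial growth into continuous ones (`continuous_besselPotential`).

The lower bound follows by exhibiting a subsolution (`separated_le_Ms`): g(t)^{1/(1-p)}|x|^s with s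
= σ/(1-p) and g' = (1-p)ε₀ϑL. The nonlinear term is handled by (E_d) with d = σp/(1-p). The linear
term needs |x|^s ≤ 𝓑|·|^s, a form of subharmonicity (`norm_rpow_le_besselPotential`): convexity if s
≥ 1, circle means and Jensen's formula if n ≥ 2. -/

noncomputable section

namespace Pseudoparabolic

variable {n : ℕ}

/-! ### The Bessel kernel as the density of a probability measure -/

/-- The heat kernel at time `s` times `e^{-s}`: the integrand of the Bessel kernel. -/
def dampedHeat (n : ℕ) (s : ℝ) (x : Space n) : ℝ :=
  Real.exp (-s) * (4 * Real.pi * s) ^ (-(n : ℝ) / 2) * Real.exp (-(‖x‖ ^ 2) / (4 * s))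

/-- The weight `(1 + |x|²)^{a/2}`. -/
def weight {n : ℕ} (a : ℝ) (x : Space n) : ℝ := (1 + ‖x‖ ^ 2) ^ (a / 2)

/-- The measure with the Bessel kernel as its density. -/
def besselMeasure (n : ℕ) : Measure (Space n) :=
  volume.withDensity fun z => ENNReal.ofReal (besselKernel n z)

lemma dampedHeat_nonneg {s : ℝ} (hs : 0 < s) (x : Space n) : 0 ≤ dampedHeat n s x := by
  unfold dampedHeat
  have : 0 < 4 * Real.pi * s := by positivity
  positivity

lemma dampedHeat_pos {s : ℝ} (hs : 0 < s) (x : Space n) : 0 < dampedHeat n s x := by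
  unfold dampedHeat
  have : 0 < 4 * Real.pi * s := by positivity
  positivity

lemma measurable_dampedHeat : Measurable (Function.uncurry (dampedHeat n)) := by
  unfold dampedHeat Function.uncurry
  fun_prop

lemma continuous_dampedHeat (s : ℝ) : Continuous (dampedHeat n s) := by
  unfold dampedHeat
  fun_prop

lemma measurable_besselKernel : Measurable (besselKernel n) := by
  have h : StronglyMeasurable fun q : Space n × ℝ => dampedHeat n q.2 q.1 :=
    (measurable_dampedHeat.comp measurable_swap).stronglyMeasurable
  exact (h.integral_prod_right' (ν := volume.restrict (Set.Ioi (0 : ℝ)))).measurable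

lemma besselKernel_nonneg (x : Space n) : 0 ≤ besselKernel n x :=
  setIntegral_nonneg measurableSet_Ioi fun _ hs => dampedHeat_nonneg hs x

lemma weight_pos (a : ℝ) (x : Space n) : 0 < weight a x := by unfold weight; positivity

lemma one_le_weight {a : ℝ} (ha : 0 ≤ a) (x : Space n) : 1 ≤ weight a x :=
  Real.one_le_rpow (by nlinarith [sq_nonneg ‖x‖]) (by positivity)

lemma continuous_weight (a : ℝ) : Continuous (weight a : Space n → ℝ) := by
  unfold weight
  exact Continuous.rpow_const (by fun_prop) fun x => Or.inl (by positivity)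

lemma integral_exp_neg_sq_div {s : ℝ} (hs : 0 < s) :
    ∫ z : Space n, Real.exp (-(‖z‖ ^ 2) / (4 * s)) = (4 * Real.pi * s) ^ ((n : ℝ) / 2) := by
  have h := GaussianFourier.integral_rexp_neg_mul_sq_norm (V := Space n)
    (b := 1 / (4 * s)) (by positivity)
  rw [finrank_euclideanSpace_fin] at h
  rw [show 4 * Real.pi * s = Real.pi / (1 / (4 * s)) by field_simp, ← h]
  congr 1; ext z; congr 1; field_simp

lemma lintegral_exp_neg_sq_div {s : ℝ} (hs : 0 < s) :
    ∫⁻ z : Space n, ENNReal.ofReal (Real.exp (-(‖z‖ ^ 2) / (4 * s)))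
      = ENNReal.ofReal ((4 * Real.pi * s) ^ ((n : ℝ) / 2)) := by
  rw [← integral_exp_neg_sq_div hs, ofReal_integral_eq_lintegral_ofReal]
  -- The Gaussian is integrable because its Bochner integral is nonzero, while a non-integrable
  -- function would have integral 0.
  · by_contra h
    have := integral_undef h
    rw [integral_exp_neg_sq_div hs] at this
    have h2 : 0 < (4 * Real.pi * s) ^ ((n : ℝ) / 2) := by positivity
    linarith
  · exact ae_of_all _ fun z => (Real.exp_pos _).le

/-- A power is dominated by an exponential, with an explicit constant. -/
lemma exists_rpow_le_exp (k : ℝ) {δ : ℝ} (hδ : 0 < δ) :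
    ∃ C : ℝ, 0 < C ∧ ∀ u : ℝ, 0 ≤ u → (1 + u) ^ k ≤ C * Real.exp (δ * u) := by
  -- For m ≥ 1, 1 + u ≤ m·e^{u/m}. Raising this to the power |k| leaves the rate |k|/m, which is at
  -- most δ.
  set m : ℝ := max 1 (|k| / δ)
  have hm1 : 1 ≤ m := le_max_left _ _
  have hm : |k| / δ ≤ m := le_max_right _ _
  refine ⟨m ^ |k|, by positivity, fun u hu => ?_⟩
  have h1 : 1 + u ≤ m * Real.exp (u / m) := by
    have := Real.add_one_le_exp (u / m)
    have h3 : m * (u / m + 1) ≤ m * Real.exp (u / m) := by gcongr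
    have h4 : m * (u / m + 1) = u + m := by field_simp
    linarith
  calc (1 + u) ^ k ≤ (1 + u) ^ |k| := Real.rpow_le_rpow_of_exponent_le (by linarith) (le_abs_self k)
    _ ≤ (m * Real.exp (u / m)) ^ |k| := by gcongr
    _ = m ^ |k| * Real.exp (u / m * |k|) := by
      rw [Real.mul_rpow (by positivity) (by positivity), ← Real.exp_mul]
    _ ≤ _ := by
      refine mul_le_mul_of_nonneg_left (Real.exp_le_exp.2 ?_) (by positivity)
      rw [div_mul_eq_mul_div, div_le_iff₀ (by positivity)]
      rw [div_le_iff₀ hδ] at hm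
      nlinarith

/-- Since 1+|z|² ≤ (1+s)(1+|z|²/s), the weight splits into a power of 1+s and a power of 1+|z|²/s.
Half of the rate in e^{-s} absorbs the first. Half of the Gaussian exponent (1/8 out of 1/4) absorbs
the second, leaving the Gaussian at time 2s. -/
lemma exists_weight_mul_dampedHeat_le (a : ℝ) (ha : 0 ≤ a) :
    ∃ C : ℝ, 0 ≤ C ∧ ∀ s : ℝ, 0 < s → ∀ z : Space n, dampedHeat n s z * weight a z ≤
      C * Real.exp (-(s / 2)) * (4 * Real.pi * s) ^ (-(n : ℝ) / 2)
        * Real.exp (-(‖z‖ ^ 2) / (4 * (2 * s))) := by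
  obtain ⟨C₁, hC₁, h₁⟩ := exists_rpow_le_exp (a / 2) (δ := 1 / 8) (by norm_num)
  obtain ⟨C₂, hC₂, h₂⟩ := exists_rpow_le_exp (a / 2) (δ := 1 / 2) (by norm_num)
  refine ⟨C₁ * C₂, by positivity, fun s hs z => ?_⟩
  have hb : 0 < 4 * Real.pi * s := by positivity
  have hw : weight a z ≤ (C₂ * Real.exp (1 / 2 * s)) * (C₁ * Real.exp (1 / 8 * (‖z‖ ^ 2 / s))) := by
    calc weight a z ≤ ((1 + s) * (1 + ‖z‖ ^ 2 / s)) ^ (a / 2) := by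
          unfold weight
          apply Real.rpow_le_rpow (by positivity) _ (by positivity)
          have : (1 + s) * (1 + ‖z‖ ^ 2 / s) = 1 + ‖z‖ ^ 2 + s + ‖z‖ ^ 2 / s := by
            field_simp; ring
          rw [this]
          have : 0 ≤ ‖z‖ ^ 2 / s := by positivity
          linarith
      _ = (1 + s) ^ (a / 2) * (1 + ‖z‖ ^ 2 / s) ^ (a / 2) :=
          Real.mul_rpow (by positivity) (by positivity)
      _ ≤ _ := by
          gcongr
          · exact h₂ s hs.le
          · exact h₁ _ (by positivity)
  calc dampedHeat n s z * weight a z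
      ≤ dampedHeat n s z * ((C₂ * Real.exp (1 / 2 * s)) *
          (C₁ * Real.exp (1 / 8 * (‖z‖ ^ 2 / s)))) :=
        mul_le_mul_of_nonneg_left hw (dampedHeat_nonneg hs z)
    _ = C₁ * C₂ * (Real.exp (-s) * Real.exp (1 / 2 * s)) * (4 * Real.pi * s) ^ (-(n : ℝ) / 2)
        * (Real.exp (-(‖z‖ ^ 2) / (4 * s)) * Real.exp (1 / 8 * (‖z‖ ^ 2 / s))) := by
        unfold dampedHeat; ring
    _ = _ := by
        rw [← Real.exp_add, ← Real.exp_add]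
        congr 3
        · congr 1; ring_nf
        · field_simp; ring

lemma lintegral_dampedHeat {s : ℝ} (hs : 0 < s) :
    ∫⁻ z : Space n, ENNReal.ofReal (dampedHeat n s z) = ENNReal.ofReal (Real.exp (-s)) := by
  have hb : 0 < 4 * Real.pi * s := by positivity
  unfold dampedHeat
  simp_rw [ENNReal.ofReal_mul (show 0 ≤ Real.exp (-s) * (4 * Real.pi * s) ^ (-(n : ℝ) / 2) by
    positivity)]
  rw [lintegral_const_mul _ (by fun_prop), lintegral_exp_neg_sq_div hs,
    ← ENNReal.ofReal_mul (by positivity), mul_assoc, ← Real.rpow_add hb]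
  congr 1
  rw [show -(n : ℝ) / 2 + n / 2 = 0 by ring, Real.rpow_zero, mul_one]

lemma lintegral_exp_neg_mul_Ioi {c : ℝ} (hc : 0 < c) :
    ∫⁻ s in Set.Ioi (0 : ℝ), ENNReal.ofReal (Real.exp (-c * s)) = ENNReal.ofReal (1 / c) := by
  rw [← ofReal_integral_eq_lintegral_ofReal]
  · rw [integral_exp_mul_Ioi (by linarith)]
    simp
  · exact (integrableOn_exp_mul_Ioi (by linarith) 0)
  · exact ae_of_all _ fun z => (Real.exp_pos _).le

lemma lintegral_lintegral_dampedHeat :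
    ∫⁻ z : Space n, ∫⁻ s in Set.Ioi (0 : ℝ), ENNReal.ofReal (dampedHeat n s z) = 1 := by
  rw [lintegral_lintegral_swap]
  · rw [setLIntegral_congr_fun (g := fun s => ENNReal.ofReal (Real.exp (-1 * s))) measurableSet_Ioi]
    · rw [lintegral_exp_neg_mul_Ioi one_pos]; simp
    · intro s hs
      simp only [lintegral_dampedHeat hs, neg_mul, one_mul]
  · exact (measurable_dampedHeat.comp measurable_swap).ennreal_ofReal.aemeasurable

/-- Where the heat integral diverges, the Bochner integral defining the kernel takes the default
value 0. The total mass is 1, so this happens only on a null set. -/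
lemma ofReal_besselKernel_ae : (fun z : Space n => ENNReal.ofReal (besselKernel n z)) =ᵐ[volume]
    fun z => ∫⁻ s in Set.Ioi (0 : ℝ), ENNReal.ofReal (dampedHeat n s z) := by
  have hmeas : Measurable fun q : Space n × ℝ => ENNReal.ofReal (dampedHeat n q.2 q.1) :=
    (measurable_dampedHeat.comp measurable_swap).ennreal_ofReal
  have hfin := ae_lt_top (μ := (volume : Measure (Space n)))
    (hmeas.lintegral_prod_right' (ν := volume.restrict (Set.Ioi (0 : ℝ))))
    (by rw [lintegral_lintegral_dampedHeat]; simp)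
  filter_upwards [hfin] with z hz
  have hnn : 0 ≤ᵐ[volume.restrict (Set.Ioi (0 : ℝ))] fun s => dampedHeat n s z :=
    (ae_restrict_mem measurableSet_Ioi).mono fun s hs => dampedHeat_nonneg hs z
  have hm : Measurable fun s => dampedHeat n s z :=
    measurable_dampedHeat.comp (by fun_prop : Measurable fun s : ℝ => (s, z))
  have hint : Integrable (fun s => dampedHeat n s z) (volume.restrict (Set.Ioi (0 : ℝ))) := by
    refine ⟨hm.aestronglyMeasurable, ?_⟩
    rw [hasFiniteIntegral_iff_ofReal hnn]
    exact hz
  exact ofReal_integral_eq_lintegral_ofReal hint hnn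

/-- Integration against the Bessel kernel is an average of integrations against heat kernels. -/
lemma lintegral_besselKernel_mul (φ : Space n → ENNReal) (x : Space n) :
    ∫⁻ y, ENNReal.ofReal (besselKernel n (x - y)) * φ y =
      ∫⁻ y, ∫⁻ s in Set.Ioi (0 : ℝ), ENNReal.ofReal (dampedHeat n s (x - y)) * φ y := by
  have hae : (fun y : Space n => ENNReal.ofReal (besselKernel n (x - y))) =ᵐ[volume]
      fun y => ∫⁻ s in Set.Ioi (0 : ℝ), ENNReal.ofReal (dampedHeat n s (x - y)) :=
    (quasiMeasurePreserving_sub_left volume x).ae_eq_comp ofReal_besselKernel_ae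
  refine lintegral_congr_ae ?_
  filter_upwards [hae] with y hy
  rw [hy, lintegral_mul_const]
  exact (measurable_dampedHeat.comp (by fun_prop : Measurable fun s : ℝ => (s, x - y))).ennreal_ofReal

lemma lintegral_besselMeasure {φ : Space n → ENNReal} (hφ : Measurable φ) :
    ∫⁻ z, φ z ∂besselMeasure n =
      ∫⁻ s in Set.Ioi (0 : ℝ), ∫⁻ z, ENNReal.ofReal (dampedHeat n s z) * φ z := by
  have hm2 : Measurable fun q : Space n × ℝ => ENNReal.ofReal (dampedHeat n q.2 q.1) * φ q.1 :=
    (measurable_dampedHeat.comp measurable_swap).ennreal_ofReal.mul (hφ.comp measurable_fst)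
  rw [← lintegral_lintegral_swap hm2.aemeasurable, besselMeasure,
    lintegral_withDensity_eq_lintegral_mul _ measurable_besselKernel.ennreal_ofReal hφ]
  refine lintegral_congr_ae ?_
  filter_upwards [ofReal_besselKernel_ae (n := n)] with z hz
  rw [Pi.mul_apply, hz, lintegral_mul_const]
  exact (measurable_dampedHeat.comp (by fun_prop : Measurable fun s : ℝ => (s, z))).ennreal_ofReal

instance : IsProbabilityMeasure (besselMeasure n) := ⟨by
  rw [← lintegral_one, lintegral_besselMeasure measurable_const]
  simp_rw [mul_one]
  rw [← lintegral_lintegral_swap]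
  · exact lintegral_lintegral_dampedHeat
  · exact (measurable_dampedHeat.comp measurable_swap).ennreal_ofReal.aemeasurable⟩

lemma integrable_weight {a : ℝ} (ha : 0 ≤ a) : Integrable (weight a) (besselMeasure n) := by
  refine ⟨(continuous_weight a).aestronglyMeasurable, ?_⟩
  rw [hasFiniteIntegral_iff_ofReal (ae_of_all _ fun z => (weight_pos a z).le),
    lintegral_besselMeasure (continuous_weight a).measurable.ennreal_ofReal]
  obtain ⟨C, hC, h⟩ := exists_weight_mul_dampedHeat_le (n := n) a ha
  have key : ∀ s ∈ Set.Ioi (0 : ℝ),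
      ∫⁻ z : Space n, ENNReal.ofReal (dampedHeat n s z) * ENNReal.ofReal (weight a z) ≤
        ENNReal.ofReal (C * 2 ^ ((n : ℝ) / 2)) * ENNReal.ofReal (Real.exp (-(1 / 2) * s)) := by
    intro s hs
    have hs : 0 < s := hs
    have hb : 0 < 4 * Real.pi * s := by positivity
    calc ∫⁻ z : Space n, ENNReal.ofReal (dampedHeat n s z) * ENNReal.ofReal (weight a z)
        ≤ ∫⁻ z : Space n, ENNReal.ofReal (C * Real.exp (-(s / 2)) *
            (4 * Real.pi * s) ^ (-(n : ℝ) / 2)) *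
              ENNReal.ofReal (Real.exp (-(‖z‖ ^ 2) / (4 * (2 * s)))) := by
          refine lintegral_mono fun z => ?_
          rw [← ENNReal.ofReal_mul (dampedHeat_nonneg hs z), ← ENNReal.ofReal_mul (by positivity)]
          exact ENNReal.ofReal_le_ofReal (h s hs z)
      _ = _ := by
          rw [lintegral_const_mul _ (by fun_prop), lintegral_exp_neg_sq_div (by positivity),
            ← ENNReal.ofReal_mul (by positivity), ← ENNReal.ofReal_mul (by positivity)]
          congr 1
          rw [show 4 * Real.pi * (2 * s) = 2 * (4 * Real.pi * s) by ring,
            Real.mul_rpow (x := 2) (by positivity) hb.le,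
            show -(n : ℝ) / 2 = -(n / 2) by ring, Real.rpow_neg hb.le]
          have : (4 * Real.pi * s) ^ ((n : ℝ) / 2) ≠ 0 := by positivity
          rw [show -(1 / 2) * s = -(s / 2) by ring]
          field_simp
  calc _ ≤ ∫⁻ s in Set.Ioi (0 : ℝ), ENNReal.ofReal (C * 2 ^ ((n : ℝ) / 2)) *
        ENNReal.ofReal (Real.exp (-(1 / 2) * s)) := setLIntegral_mono (by fun_prop) key
    _ < ⊤ := by
        rw [lintegral_const_mul _ (by fun_prop), lintegral_exp_neg_mul_Ioi (by norm_num)]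
        exact ENNReal.mul_lt_top ENNReal.ofReal_lt_top ENNReal.ofReal_lt_top

/-- No hypothesis on φ is needed, because the density formula and the substitution z = x - y also
hold for the default value of a divergent integral. -/
lemma besselPotential_eq (φ : Space n → ℝ) (x : Space n) :
    besselPotential φ x = ∫ z, φ (x - z) ∂besselMeasure n := by
  unfold besselPotential besselMeasure
  rw [integral_withDensity_eq_integral_toReal_smul measurable_besselKernel.ennreal_ofReal
    (ae_of_all _ fun z => ENNReal.ofReal_lt_top),
    ← integral_sub_left_eq_self _ volume x]
  simp [ENNReal.toReal_ofReal (besselKernel_nonneg _)]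

lemma besselKernel_congr {x y : Space n} (h : ‖x‖ = ‖y‖) : besselKernel n x = besselKernel n y := by
  unfold besselKernel; rw [h]

lemma measurePreserving_besselMeasure (R : Space n ≃ₗᵢ[ℝ] Space n) :
    MeasurePreserving R (besselMeasure n) (besselMeasure n) := by
  refine ⟨R.continuous.measurable, ?_⟩
  ext s hs
  rw [Measure.map_apply R.continuous.measurable hs, besselMeasure,
    withDensity_apply _ hs, withDensity_apply _ (R.continuous.measurable hs),
    ← R.measurePreserving.setLIntegral_comp_preimage hs measurable_besselKernel.ennreal_ofReal]
  exact lintegral_congr fun z => by rw [besselKernel_congr (R.norm_map z)]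

lemma integral_besselMeasure_comp (R : Space n ≃ₗᵢ[ℝ] Space n) (f : Space n → ℝ) :
    ∫ z, f (R z) ∂besselMeasure n = ∫ z, f z ∂besselMeasure n :=
  (measurePreserving_besselMeasure R).integral_comp R.toHomeomorph.measurableEmbedding f

lemma besselMeasure_far_pos (hn : 1 ≤ n) : 0 < besselMeasure n {z | 2 ≤ ‖z‖} := by
  have hms : MeasurableSet {z : Space n | 2 ≤ ‖z‖} :=
    (isClosed_le continuous_const continuous_norm).measurableSet
  have hvol : 0 < (volume : Measure (Space n)) {z | 2 ≤ ‖z‖} := by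
    have hopen : IsOpen {z : Space n | 2 < ‖z‖} := isOpen_lt continuous_const continuous_norm
    refine lt_of_lt_of_le (hopen.measure_pos volume ?_) (measure_mono fun z (hz : 2 < ‖z‖) => hz.le)
    exact ⟨EuclideanSpace.single ⟨0, hn⟩ 3, by simp; norm_num⟩
  have hS : besselMeasure n {z | 2 ≤ ‖z‖} = ∫⁻ s in Set.Ioi (0 : ℝ),
      ∫⁻ z in {z : Space n | 2 ≤ ‖z‖}, ENNReal.ofReal (dampedHeat n s z) := by
    rw [← lintegral_indicator_one hms, lintegral_besselMeasure (measurable_one.indicator hms)]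
    refine lintegral_congr fun s => ?_
    rw [← lintegral_indicator hms]
    refine lintegral_congr fun z => ?_
    by_cases hz : z ∈ {z : Space n | 2 ≤ ‖z‖} <;> simp [Set.indicator, hz]
  have hm : Measurable fun q : ℝ × Space n => ENNReal.ofReal (dampedHeat n q.1 q.2) :=
    measurable_dampedHeat.ennreal_ofReal
  rw [hS, setLIntegral_pos_iff hm.lintegral_prod_right']
  have : Set.Ioi (0 : ℝ) ⊆ Function.support (fun s => ∫⁻ z in {z : Space n | 2 ≤ ‖z‖},
      ENNReal.ofReal (dampedHeat n s z)) := by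
    intro s hs
    rw [Function.mem_support, ← pos_iff_ne_zero, setLIntegral_pos_iff
      (continuous_dampedHeat s).measurable.ennreal_ofReal]
    convert! hvol using 2
    rw [Set.inter_eq_right]
    intro z _
    simp [dampedHeat_pos hs z]
  rw [Set.inter_eq_right.2 this]
  simp

/-! ### The Bessel potential on functions of polynomial growth -/

/-- Peetre's inequality 1+|x-z|² ≤ 2(1+|x|²)(1+|z|²). It separates the variables, so that moments of
the Bessel measure bound 𝓑 on weights. -/
lemma weight_sub_le {a : ℝ} (ha : 0 ≤ a) (x z : Space n) :
    weight a (x - z) ≤ 2 ^ (a / 2) * weight a x * weight a z := by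
  unfold weight
  rw [← Real.mul_rpow (by positivity) (by positivity), ← Real.mul_rpow (by positivity)
    (by positivity)]
  apply Real.rpow_le_rpow (by positivity) _ (by positivity)
  have h1 : ‖x - z‖ ≤ ‖x‖ + ‖z‖ := norm_sub_le x z
  have h2 : ‖x - z‖ ^ 2 ≤ (‖x‖ + ‖z‖) ^ 2 := by gcongr
  nlinarith [sq_nonneg (‖x‖ - ‖z‖), sq_nonneg (‖x‖ * ‖z‖)]

/-- The constant in the bound of the Bessel potential of `weight a`. -/
def besselConst (n : ℕ) (a : ℝ) : ℝ := 2 ^ (a / 2) * ∫ z : Space n, weight a z ∂besselMeasure n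

lemma besselConst_nonneg (a : ℝ) : 0 ≤ besselConst n a :=
  mul_nonneg (by positivity) (integral_nonneg fun z => (weight_pos a z).le)

lemma integrable_comp_sub {a C : ℝ} (ha : 0 ≤ a) {φ : Space n → ℝ} (hφ : Measurable φ)
    (hb : ∀ y, |φ y| ≤ C * weight a y) (x : Space n) :
    Integrable (fun z => φ (x - z)) (besselMeasure n) := by
  have hC : 0 ≤ C := by
    have h := (abs_nonneg _).trans (hb 0)
    exact nonneg_of_mul_nonneg_left h (weight_pos a 0)
  refine ((integrable_weight ha).const_mul (C * (2 ^ (a / 2) * weight a x))).mono'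
    (hφ.comp (measurable_const.sub measurable_id)).aestronglyMeasurable (ae_of_all _ fun z => ?_)
  rw [Real.norm_eq_abs, mul_assoc]
  exact (hb _).trans (mul_le_mul_of_nonneg_left (weight_sub_le ha x z) hC)

lemma besselPotential_nonneg {φ : Space n → ℝ} (h : ∀ y, 0 ≤ φ y) (x : Space n) :
    0 ≤ besselPotential φ x := by
  rw [besselPotential_eq]
  exact integral_nonneg fun z => h _

lemma besselPotential_mono {a C : ℝ} (ha : 0 ≤ a) {φ ψ : Space n → ℝ} (h0 : ∀ y, 0 ≤ φ y)
    (h : ∀ y, φ y ≤ ψ y) (hψ : Measurable ψ) (hb : ∀ y, |ψ y| ≤ C * weight a y) (x : Space n) :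
    besselPotential φ x ≤ besselPotential ψ x := by
  rw [besselPotential_eq, besselPotential_eq]
  exact integral_mono_of_nonneg (ae_of_all _ fun z => h0 _) (integrable_comp_sub ha hψ hb x)
    (ae_of_all _ fun z => h _)

lemma besselPotential_const_mul (c : ℝ) (φ : Space n → ℝ) (x : Space n) :
    besselPotential (fun y => c * φ y) x = c * besselPotential φ x := by
  rw [besselPotential_eq, besselPotential_eq, integral_const_mul]

lemma besselPotential_weight_le {a : ℝ} (ha : 0 ≤ a) (x : Space n) :
    besselPotential (weight a) x ≤ besselConst n a * weight a x := by
  rw [besselPotential_eq]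
  calc ∫ z, weight a (x - z) ∂besselMeasure n
      ≤ ∫ z, 2 ^ (a / 2) * weight a x * weight a z ∂besselMeasure n :=
        integral_mono_of_nonneg (ae_of_all _ fun z => (weight_pos _ _).le)
          ((integrable_weight ha).const_mul _) (ae_of_all _ fun z => weight_sub_le ha x z)
    _ = _ := by rw [integral_const_mul, besselConst]; ring

lemma abs_weight_le (a : ℝ) (x : Space n) : |weight a x| ≤ 1 * weight a x := by
  rw [abs_of_pos (weight_pos a x), one_mul]

lemma besselPotential_le {a C : ℝ} (ha : 0 ≤ a) {φ : Space n → ℝ} (h0 : ∀ y, 0 ≤ φ y)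
    (h : ∀ y, φ y ≤ C * weight a y) (x : Space n) :
    besselPotential φ x ≤ C * (besselConst n a * weight a x) := by
  have hC : 0 ≤ C := nonneg_of_mul_nonneg_left ((h0 0).trans (h 0)) (weight_pos a 0)
  refine (besselPotential_mono (ψ := fun y => C * weight a y) (C := C) ha h0 h
    ((continuous_weight a).measurable.const_mul C) (fun y => ?_) x).trans ?_
  · rw [abs_of_nonneg (mul_nonneg hC (weight_pos a y).le)]
  · rw [besselPotential_const_mul]
    exact mul_le_mul_of_nonneg_left (besselPotential_weight_le ha x) hC

lemma continuous_besselPotential_weight {a : ℝ} (ha : 0 ≤ a) :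
    Continuous (besselPotential (weight a : Space n → ℝ)) := by
  rw [continuous_iff_continuousAt]
  intro x₀
  have heq : besselPotential (weight a : Space n → ℝ) =
      fun x => ∫ z, weight a (x - z) ∂besselMeasure n := funext fun x => besselPotential_eq _ x
  rw [heq]
  have hw := (continuous_weight (n := n) a)
  refine continuousAt_of_dominated
    (bound := fun z => 2 ^ (a / 2) * (weight a x₀ + 1) * weight a z) ?_ ?_ ?_ ?_
  · exact Eventually.of_forall fun x => (hw.comp (by fun_prop)).aestronglyMeasurable
  · have : ∀ᶠ x in 𝓝 x₀, weight a x < weight a x₀ + 1 :=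
      hw.continuousAt.eventually (gt_mem_nhds (lt_add_one _))
    filter_upwards [this] with x hx
    refine ae_of_all _ fun z => ?_
    rw [Real.norm_eq_abs, abs_of_pos (weight_pos _ _)]
    refine (weight_sub_le ha x z).trans ?_
    have := weight_pos a z
    gcongr
  · exact (integrable_weight ha).const_mul _
  · exact ae_of_all _ fun z => (hw.comp (by fun_prop : Continuous fun x => x - z)).continuousAt

/-- Heat kernels are continuous in x, whereas the Bessel kernel may be singular at the origin. The
double integral is therefore the form suited to Fatou's lemma. -/
lemma ofReal_besselPotential {a C : ℝ} (ha : 0 ≤ a) {φ : Space n → ℝ} (hφ : Measurable φ)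
    (h0 : ∀ y, 0 ≤ φ y) (h : ∀ y, φ y ≤ C * weight a y) (x : Space n) :
    ENNReal.ofReal (besselPotential φ x) =
      ∫⁻ y, ∫⁻ s in Set.Ioi (0 : ℝ), ENNReal.ofReal (dampedHeat n s (x - y)) *
        ENNReal.ofReal (φ y) := by
  have hint := integrable_comp_sub ha hφ (fun y => (abs_of_nonneg (h0 y)).trans_le (h y)) x
  rw [← lintegral_besselKernel_mul, besselPotential_eq,
    ofReal_integral_eq_lintegral_ofReal hint (ae_of_all _ fun z => h0 _), besselMeasure,
    lintegral_withDensity_eq_lintegral_mul _ measurable_besselKernel.ennreal_ofReal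
      (show Measurable fun z => ENNReal.ofReal (φ (x - z)) from
        (hφ.comp (measurable_const.sub measurable_id)).ennreal_ofReal),
    ← lintegral_sub_left_eq_self _ x]
  simp

/-- Fatou's lemma, once in y and once in s, with an integrand continuous in x. -/
lemma lowerSemicontinuous_besselPotential {a C : ℝ} (ha : 0 ≤ a) {φ : Space n → ℝ}
    (hφ : Measurable φ) (h0 : ∀ y, 0 ≤ φ y) (h : ∀ y, φ y ≤ C * weight a y) :
    LowerSemicontinuous (besselPotential φ) := by
  have hE : LowerSemicontinuous fun x => ENNReal.ofReal (besselPotential φ x) := by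
    rw [lowerSemicontinuous_iff_le_liminf]
    intro x₀
    simp_rw [ofReal_besselPotential ha hφ h0 h]
    have hm : ∀ x, Measurable fun q : Space n × ℝ =>
        ENNReal.ofReal (dampedHeat n q.2 (x - q.1)) * ENNReal.ofReal (φ q.1) := fun x =>
      (measurable_dampedHeat.comp (by fun_prop : Measurable fun q : Space n × ℝ =>
        (q.2, x - q.1))).ennreal_ofReal.mul (hφ.comp measurable_fst).ennreal_ofReal
    refine le_trans ?_ (lintegral_liminf_le fun x => (hm x).lintegral_prod_right')
    refine lintegral_mono fun y => ?_
    refine le_trans ?_ (lintegral_liminf_le fun x =>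
      (hm x).comp (by fun_prop : Measurable fun s : ℝ => (y, s)))
    refine lintegral_mono fun s => ?_
    have hc : ContinuousAt (fun x => ENNReal.ofReal (dampedHeat n s (x - y)) *
        ENNReal.ofReal (φ y)) x₀ := by
      refine ENNReal.Tendsto.mul_const ?_ (Or.inr ENNReal.ofReal_ne_top)
      exact ((ENNReal.continuous_ofReal.comp (continuous_dampedHeat s)).comp
        (by fun_prop : Continuous fun x => x - y)).continuousAt
    exact (Tendsto.liminf_eq hc).ge
  intro x₀ c hc
  rcases lt_or_ge c 0 with hc0 | hc0
  · exact Eventually.of_forall fun x => hc0.trans_le (besselPotential_nonneg h0 x)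
  · have := hE x₀ (ENNReal.ofReal c) ((ENNReal.ofReal_lt_ofReal_iff_of_nonneg hc0).2 hc)
    filter_upwards [this] with x hx
    exact (ENNReal.ofReal_lt_ofReal_iff_of_nonneg hc0).1 hx

/-- The Bessel potential of a measurable function of polynomial growth is continuous. -/
theorem continuous_besselPotential {a C : ℝ} (ha : 0 ≤ a) {φ : Space n → ℝ} (hφ : Measurable φ)
    (h0 : ∀ y, 0 ≤ φ y) (h : ∀ y, φ y ≤ C * weight a y) : Continuous (besselPotential φ) := by
  have hlow := lowerSemicontinuous_besselPotential ha hφ h0 h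
  have hw := (continuous_weight (n := n) a).measurable
  have hC : 0 ≤ C := nonneg_of_mul_nonneg_left ((h0 0).trans (h 0)) (weight_pos a 0)
  -- Lower semicontinuity for the complement C·w_a - φ becomes upper semicontinuity for φ, because 𝓑
  -- w_a is continuous.
  have hcomp : LowerSemicontinuous (besselPotential fun y => C * weight a y - φ y) :=
    lowerSemicontinuous_besselPotential (C := C) ha ((hw.const_mul C).sub hφ)
      (fun y => sub_nonneg.2 (h y)) (fun y => sub_le_self _ (h0 y))
  have heq : ∀ x, besselPotential (fun y => C * weight a y - φ y) x =
      C * besselPotential (weight a) x - besselPotential φ x := by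
    intro x
    rw [besselPotential_eq, besselPotential_eq, besselPotential_eq, integral_sub,
      integral_const_mul]
    · exact (integrable_comp_sub ha hw (abs_weight_le a) x).const_mul C
    · exact integrable_comp_sub ha hφ (fun y => (abs_of_nonneg (h0 y)).trans_le (h y)) x
  have hcw := (continuous_besselPotential_weight (n := n) ha).const_mul C
  have hup : UpperSemicontinuous (besselPotential φ) := by
    intro x₀ c hc
    have hlt : C * besselPotential (weight a) x₀ - c <
        besselPotential (fun y => C * weight a y - φ y) x₀ := by rw [heq]; linarith
    obtain ⟨e, he1, he2⟩ := exists_between hlt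
    have h1 := hcomp x₀ e he2
    have h2 := hcw.continuousAt.eventually (gt_mem_nhds
      (show C * besselPotential (weight a) x₀ < e + c by linarith))
    filter_upwards [h1, h2] with x hx1 hx2
    rw [heq] at hx1
    linarith
  exact continuous_iff_lower_upperSemicontinuous.2 ⟨hlow, hup⟩

/-! ### Lower estimates for the Bessel potential of powers -/

lemma norm_rpow_le_weight {s a : ℝ} (hs : 0 ≤ s) (hsa : s ≤ a) (y : Space n) :
    ‖y‖ ^ s ≤ weight a y := by
  have h1 : ‖y‖ ^ s = (‖y‖ ^ 2) ^ (s / 2) := by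
    rw [← Real.rpow_natCast, ← Real.rpow_mul (norm_nonneg _)]
    congr 1; push_cast; ring
  rw [h1]
  unfold weight
  calc (‖y‖ ^ 2) ^ (s / 2) ≤ (1 + ‖y‖ ^ 2) ^ (s / 2) :=
        Real.rpow_le_rpow (by positivity) (by linarith) (by positivity)
    _ ≤ _ := Real.rpow_le_rpow_of_exponent_le (by nlinarith [sq_nonneg ‖y‖]) (by linarith)

lemma continuous_norm_rpow {s : ℝ} (hs : 0 ≤ s) : Continuous fun y : Space n => ‖y‖ ^ s :=
  continuous_norm.rpow_const fun _ => Or.inr hs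

lemma integrable_norm_sub_rpow {s : ℝ} (hs : 0 ≤ s) (x : Space n) :
    Integrable (fun z => ‖x - z‖ ^ s) (besselMeasure n) :=
  integrable_comp_sub (C := 1) hs (continuous_norm_rpow hs).measurable (fun y => by
    rw [one_mul, abs_of_nonneg (by positivity)]; exact norm_rpow_le_weight hs le_rfl y) x

/-- The half of `{|z| ≥ 2}` that points away from `x`. -/
def farHalf (x : Space n) : Set (Space n) := {z | 2 ≤ ‖z‖ ∧ inner ℝ x z ≤ 0}

lemma measurableSet_farHalf (x : Space n) : MeasurableSet (farHalf x) :=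
  (((isClosed_le continuous_const continuous_norm).inter (isClosed_le
    (continuous_const.inner continuous_id) continuous_const)).measurableSet :
      MeasurableSet ({z | 2 ≤ ‖z‖} ∩ {z | inner ℝ x z ≤ 0}))

/-- The set and its reflection under z ↦ -z cover {|z| ≥ 2} and have equal mass. -/
lemma besselMeasure_farHalf (x : Space n) :
    (besselMeasure n).real {z | 2 ≤ ‖z‖} / 2 ≤ (besselMeasure n).real (farHalf x) := by
  have hneg : (besselMeasure n).real ((LinearIsometryEquiv.neg ℝ) ⁻¹' farHalf x) =
      (besselMeasure n).real (farHalf x) :=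
    (measurePreserving_besselMeasure (LinearIsometryEquiv.neg ℝ)).measureReal_preimage
      (measurableSet_farHalf x).nullMeasurableSet
  have hsub : {z : Space n | 2 ≤ ‖z‖} ⊆
      farHalf x ∪ (LinearIsometryEquiv.neg ℝ) ⁻¹' farHalf x := by
    intro z hz
    rcases le_total (inner ℝ x z) 0 with h | h
    · exact Or.inl ⟨hz, h⟩
    · exact Or.inr ⟨by simpa using hz, by simpa using h⟩
  have := (measureReal_mono (μ := besselMeasure n) hsub (measure_ne_top _ _)).trans
    (measureReal_union_le _ _)
  rw [hneg] at this
  linarith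

/-- Both bounds come from |x-z|² = |x|² - 2⟨x,z⟩ + |z|² ≥ |x|² + 4. -/
lemma norm_sub_ge_of_mem_farHalf {x z : Space n} (hz : z ∈ farHalf x) :
    1 ≤ ‖x - z‖ ∧ ‖x‖ ≤ ‖x - z‖ := by
  have h := norm_sub_sq_real x z
  have h1 : 2 ≤ ‖z‖ := hz.1
  have h2 : inner ℝ x z ≤ 0 := hz.2
  constructor
  · refine le_of_sq_le_sq ?_ (norm_nonneg _)
    nlinarith [sq_nonneg ‖x‖]
  · refine le_of_sq_le_sq ?_ (norm_nonneg _)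
    nlinarith [sq_nonneg ‖x‖]

/-- Restrict the average to `farHalf x`, where V(x-z,t)|x-z|^d ≥ ϑl·L(t)·|x-z|^{σ+d} ≥
ϑl·L(t)·|x|^{σ+d}. Only the mass of that set enters the constant, so d does not. -/
theorem exists_besselLowerEstimate (hn : 1 ≤ n) {σ ϑl ϑu : ℝ} (hσ : 0 ≤ σ) (hϑl : 0 < ϑl)
    {L : ℝ → ℝ} (hLpos : ∀ t, 0 < t → 0 < L t) {V : Space n → ℝ → ℝ}
    (hVcont : ContinuousOn (Function.uncurry V) (Set.univ ×ˢ Set.Ioi 0))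
    (hVnonneg : ∀ x t, 0 < t → 0 ≤ V x t)
    (hVlower : ∀ x t, 1 ≤ ‖x‖ → 0 < t → ϑl * L t * ‖x‖ ^ σ ≤ V x t)
    (hVupper : ∀ x t, 0 < t → V x t ≤ ϑu * L t * ‖x‖ ^ σ) :
    ∃ ε₀ : ℝ, 0 < ε₀ ∧ ∀ d : ℝ, 0 ≤ d → BesselLowerEstimate σ ϑl L V ε₀ d := by
  refine ⟨(besselMeasure n).real {z | 2 ≤ ‖z‖} / 2,
    half_pos (ENNReal.toReal_pos (besselMeasure_far_pos hn).ne' (measure_ne_top _ _)), ?_⟩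
  intro d hd x t ht
  have hVc : Continuous fun y => V y t := by
    rw [← continuousOn_univ]
    exact hVcont.comp (by fun_prop : ContinuousOn (fun y : Space n => (y, t)) Set.univ)
      fun y _ => ⟨trivial, ht⟩
  have hint : Integrable (fun z => V (x - z) t * ‖x - z‖ ^ d) (besselMeasure n) := by
    refine integrable_comp_sub (a := σ + d) (C := ϑu * L t) (φ := fun y => V y t * ‖y‖ ^ d)
      (by positivity) (hVc.mul (continuous_norm_rpow hd)).measurable (fun y => ?_) x
    have h0 := hVnonneg y t ht
    have hC : 0 ≤ ϑu * L t := by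
      -- At a unit vector, 0 ≤ V ≤ ϑu·L(t), which gives the sign of the coefficient.
      have h1 := (hVnonneg (EuclideanSpace.single ⟨0, hn⟩ 1) t ht).trans (hVupper _ t ht)
      simpa using h1
    rw [abs_of_nonneg (by positivity)]
    calc V y t * ‖y‖ ^ d ≤ ϑu * L t * ‖y‖ ^ σ * ‖y‖ ^ d := by gcongr; exact hVupper y t ht
      _ = ϑu * L t * ‖y‖ ^ (σ + d) := by rw [Real.rpow_add_of_nonneg (norm_nonneg _) hσ hd]; ring
      _ ≤ _ := mul_le_mul_of_nonneg_left (norm_rpow_le_weight (by positivity) le_rfl y) hC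
  have hL := hLpos t ht
  rw [besselPotential_eq]
  calc (besselMeasure n).real {z | 2 ≤ ‖z‖} / 2 * (ϑl * L t) * ‖x‖ ^ (σ + d)
      ≤ (besselMeasure n).real (farHalf x) * (ϑl * L t * ‖x‖ ^ (σ + d)) := by
        rw [mul_assoc]
        exact mul_le_mul_of_nonneg_right (besselMeasure_farHalf x) (by positivity)
    _ = ∫ z, (farHalf x).indicator (fun _ => ϑl * L t * ‖x‖ ^ (σ + d)) z ∂besselMeasure n := by
        rw [integral_indicator_const _ (measurableSet_farHalf x), smul_eq_mul]
    _ ≤ _ := by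
        refine integral_mono_of_nonneg (ae_of_all _ fun z => Set.indicator_nonneg
          (fun _ _ => by positivity) z) hint (ae_of_all _ fun z => ?_)
        refine Set.indicator_apply_le' (fun hz => ?_) (fun _ => ?_)
        · obtain ⟨h1, h2⟩ := norm_sub_ge_of_mem_farHalf hz
          calc ϑl * L t * ‖x‖ ^ (σ + d) ≤ ϑl * L t * ‖x - z‖ ^ (σ + d) := by gcongr
            _ = ϑl * L t * ‖x - z‖ ^ σ * ‖x - z‖ ^ d := by
                rw [Real.rpow_add_of_nonneg (norm_nonneg _) hσ hd]; ring
            _ ≤ _ := mul_le_mul_of_nonneg_right (hVlower _ t h1 ht) (by positivity)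
        · exact mul_nonneg (hVnonneg _ t ht) (by positivity)

/-! ### Powers with exponent in `JPlus` are increased by the Bessel potential -/

/-- The reflection in the hyperplane orthogonal to x - y swaps x and y and preserves the Bessel
measure. -/
lemma besselPotential_norm_rpow_radial {s : ℝ} {x y : Space n} (h : ‖x‖ = ‖y‖) :
    besselPotential (fun y => ‖y‖ ^ s) x = besselPotential (fun y => ‖y‖ ^ s) y := by
  let R : Space n ≃ₗᵢ[ℝ] Space n := Submodule.reflection (Submodule.span ℝ {x - y})ᗮ
  have hR : R x = y := Submodule.reflection_sub h
  rw [besselPotential_eq, besselPotential_eq,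
    ← integral_besselMeasure_comp R fun z => ‖y - z‖ ^ s, ← hR]
  simp_rw [← map_sub R, LinearIsometryEquiv.norm_map]

/-- Here |·|^s is convex, so |x|^s is at most the mean of |x-z|^s and |x+z|^s. These two have the
same integral by symmetry. -/
lemma norm_rpow_le_besselPotential_of_one_le {s : ℝ} (hs : 1 ≤ s) (x : Space n) :
    ‖x‖ ^ s ≤ besselPotential (fun y => ‖y‖ ^ s) x := by
  have hint := integrable_norm_sub_rpow (zero_le_one.trans hs) x
  have hneg : ∫ z, ‖x + z‖ ^ s ∂besselMeasure n = ∫ z, ‖x - z‖ ^ s ∂besselMeasure n := by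
    rw [← integral_besselMeasure_comp (LinearIsometryEquiv.neg ℝ)]
    simp [sub_eq_add_neg]
  have hint' : Integrable (fun z => ‖x + z‖ ^ s) (besselMeasure n) := by
    have := (measurePreserving_besselMeasure (n := n) (LinearIsometryEquiv.neg ℝ)).integrable_comp
      hint.aestronglyMeasurable
    have h2 := this.2 hint
    simpa [Function.comp_def] using h2
  have key : ∀ z : Space n, ‖x‖ ^ s ≤ (1 / 2) * ‖x - z‖ ^ s + (1 / 2) * ‖x + z‖ ^ s := by
    intro z
    have h1 : ‖x‖ ≤ (1 / 2) * ‖x - z‖ + (1 / 2) * ‖x + z‖ := by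
      have := norm_add_le (x - z) (x + z)
      rw [show x - z + (x + z) = (2 : ℝ) • x by rw [two_smul]; abel, norm_smul] at this
      norm_num at this
      linarith
    refine (Real.rpow_le_rpow (norm_nonneg _) h1 (by linarith)).trans ?_
    have := (convexOn_rpow hs).2 (norm_nonneg (x - z)) (norm_nonneg (x + z))
      (show (0 : ℝ) ≤ 1 / 2 by norm_num) (show (0 : ℝ) ≤ 1 / 2 by norm_num) (by norm_num)
    simpa using this
  rw [besselPotential_eq]
  calc ‖x‖ ^ s = ∫ z, ‖x‖ ^ s ∂besselMeasure n := by simp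
    _ ≤ ∫ z, ((1 / 2) * ‖x - z‖ ^ s + (1 / 2) * ‖x + z‖ ^ s) ∂besselMeasure n :=
        integral_mono (integrable_const _) ((hint.const_mul _).add (hint'.const_mul _)) key
    _ = _ := by
        rw [integral_add (hint.const_mul _) (hint'.const_mul _), integral_const_mul,
          integral_const_mul, hneg]
        ring

/-- The mean over a circle of `|· - a|^s` is at least the `s`-th power of the radius. -/
lemma rpow_le_integral_circleMap {s r : ℝ} (hs : 0 ≤ s) (hr : 0 < r) (a : ℂ) :
    2 * Real.pi * r ^ s ≤ ∫ θ in (0 : ℝ)..2 * Real.pi, ‖circleMap 0 r θ - a‖ ^ s := by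
  have hpi := Real.two_pi_pos
  have hlog : IntervalIntegrable (fun θ => Real.log ‖circleMap 0 r θ - a‖) volume 0
      (2 * Real.pi) := circleIntegrable_log_norm_sub_const (a := a) (c := 0) r
  -- Jensen's formula: the circle mean of log|ζ-a| is log r plus a nonnegative term.
  have hmean : 2 * Real.pi * Real.log r ≤
      ∫ θ in (0 : ℝ)..2 * Real.pi, Real.log ‖circleMap 0 r θ - a‖ := by
    have h := circleAverage_log_norm_sub_const_eq_log_radius_add_posLog (c := 0) (a := a) hr.ne'
    have hp : 0 ≤ Real.posLog (r⁻¹ * ‖0 - a‖) := Real.posLog_nonneg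
    rw [Real.circleAverage, smul_eq_mul, inv_mul_eq_div, div_eq_iff hpi.ne'] at h
    have h' : ∫ θ in (0 : ℝ)..2 * Real.pi, Real.log ‖circleMap 0 r θ - a‖ = _ := h
    rw [h', mul_comm (2 * Real.pi)]
    exact mul_le_mul_of_nonneg_right (by linarith) hpi.le
  -- Points with ζ = a must be excluded: there log 0 = 0 by convention, and the tangent inequality
  -- below can fail.
  have hnull : ∀ᵐ θ ∂volume, circleMap 0 r θ ≠ a := by
    have hc : (circleMap 0 r ⁻¹' {a}).Countable :=
      (Set.countable_singleton a).preimage_circleMap 0 hr.ne'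
    filter_upwards [hc.ae_notMem volume] with θ hθ h
    exact hθ h
  -- With u = |ζ-a|, the bound e^v ≥ 1 + v gives u^s ≥ r^s(1 + s(log u - log r)). Integrating this
  -- reduces the claim to the logarithmic mean.
  calc 2 * Real.pi * r ^ s
      ≤ ∫ θ in (0 : ℝ)..2 * Real.pi,
          (r ^ s * (1 - s * Real.log r) + r ^ s * s * Real.log ‖circleMap 0 r θ - a‖) := by
        rw [intervalIntegral.integral_add (by simp) (hlog.const_mul _),
          intervalIntegral.integral_const, intervalIntegral.integral_const_mul]
        have : 0 ≤ r ^ s * s := by positivity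
        simp only [sub_zero, smul_eq_mul]
        nlinarith [mul_le_mul_of_nonneg_left hmean this]
    _ ≤ _ := by
        refine intervalIntegral.integral_mono_ae hpi.le ((by simp : IntervalIntegrable _ _ _ _).add
          (hlog.const_mul _)) ?_ ?_
        · refine Continuous.intervalIntegrable ?_ _ _
          exact ((continuous_circleMap 0 r).sub continuous_const).norm.rpow_const
            fun _ => Or.inr hs
        · filter_upwards [hnull] with θ hθ
          have hpos : 0 < ‖circleMap 0 r θ - a‖ := norm_pos_iff.2 (sub_ne_zero.2 hθ)
          set u := ‖circleMap 0 r θ - a‖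
          have h1 : u ^ s = r ^ s * Real.exp (s * (Real.log u - Real.log r)) := by
            rw [Real.rpow_def_of_pos hpos, Real.rpow_def_of_pos hr, ← Real.exp_add]
            congr 1; ring
          rw [h1]
          have h2 := Real.add_one_le_exp (s * (Real.log u - Real.log r))
          have h3 : 0 < r ^ s := by positivity
          nlinarith [mul_le_mul_of_nonneg_left h2 h3.le]

/-- The isometric embedding of `ℂ` on two coordinates of `ℝⁿ`. -/
def planeEmbedding (i j : Fin n) (ζ : ℂ) : Space n :=
  ζ.re • EuclideanSpace.single i 1 + ζ.im • EuclideanSpace.single j 1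

lemma norm_planeEmbedding {i j : Fin n} (hij : i ≠ j) (ζ : ℂ) : ‖planeEmbedding i j ζ‖ = ‖ζ‖ := by
  have h : ‖planeEmbedding i j ζ‖ ^ 2 = ‖ζ‖ ^ 2 := by
    rw [planeEmbedding, norm_add_sq_real, Complex.sq_norm, Complex.normSq_apply]
    simp [norm_smul, inner_smul_left, inner_smul_right, EuclideanSpace.inner_single_left, hij]
    ring
  exact (sq_eq_sq₀ (norm_nonneg _) (norm_nonneg _)).1 h

/-- Dropping all coordinates except i and j only decreases the norm. This reduces circle means in ℝⁿ
to circle means in ℂ. -/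
lemma norm_sub_le_norm_planeEmbedding_sub {i j : Fin n} (hij : i ≠ j) (ζ : ℂ) (z : Space n) :
    ‖ζ - ⟨z i, z j⟩‖ ≤ ‖planeEmbedding i j ζ - z‖ := by
  refine le_of_sq_le_sq ?_ (norm_nonneg _)
  rw [EuclideanSpace.norm_sq_eq, Complex.sq_norm, Complex.normSq_apply]
  refine le_trans (le_of_eq ?_) (Finset.sum_le_sum_of_subset_of_nonneg (Finset.subset_univ {i, j})
    fun k _ _ => sq_nonneg _)
  rw [Finset.sum_pair hij]
  simp [planeEmbedding, hij, hij.symm]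
  ring

lemma continuous_planeEmbedding (i j : Fin n) : Continuous (planeEmbedding i j) := by
  unfold planeEmbedding
  fun_prop

/-- The potential is radial, so it equals its mean over a circle of radius |x| in a coordinate
plane. Fubini moves this mean inside the integral over z, where `rpow_le_integral_circleMap` applies
for each z. -/
lemma norm_rpow_le_besselPotential_of_two_le {s : ℝ} (hn : 2 ≤ n) (hs : 0 ≤ s) {x : Space n}
    (hx : x ≠ 0) : ‖x‖ ^ s ≤ besselPotential (fun y => ‖y‖ ^ s) x := by
  set r := ‖x‖ with hrdef
  have hr : 0 < r := norm_pos_iff.2 hx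
  have hpi := Real.two_pi_pos
  let i : Fin n := ⟨0, by omega⟩
  let j : Fin n := ⟨1, by omega⟩
  have hij : i ≠ j := by simp [i, j]
  let J : ℝ → Space n := fun θ => planeEmbedding i j (circleMap 0 r θ)
  have hJc : Continuous J := (continuous_planeEmbedding i j).comp (continuous_circleMap 0 r)
  have hJn : ∀ θ, ‖J θ‖ = r := fun θ => by
    simp only [J, norm_planeEmbedding hij, norm_circleMap_zero, abs_of_pos hr]
  have hJw : ∀ θ, weight s (J θ) = weight s x := fun θ => by unfold weight; rw [hJn]
  let h : ℝ → Space n → ℝ := fun θ z => ‖J θ - z‖ ^ s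
  have hF : ∀ θ, ∫ z, h θ z ∂besselMeasure n = besselPotential (fun y => ‖y‖ ^ s) x := fun θ => by
    rw [besselPotential_norm_rpow_radial (hrdef.symm.trans (hJn θ).symm), besselPotential_eq]
  have hcont : Continuous (Function.uncurry h) :=
    (((hJc.comp continuous_fst).sub continuous_snd).norm).rpow_const fun _ => Or.inr hs
  have hint : Integrable (Function.uncurry h)
      ((volume.restrict (Set.Ioc 0 (2 * Real.pi))).prod (besselMeasure n)) := by
    have hb := ((integrable_weight (n := n) hs).const_mul (2 ^ (s / 2) * weight s x)).comp_snd
      (volume.restrict (Set.Ioc 0 (2 * Real.pi)))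
    refine hb.mono' hcont.aestronglyMeasurable (ae_of_all _ fun q => ?_)
    have h0 : 0 ≤ h q.1 q.2 := by simp only [h]; positivity
    rw [Function.uncurry, Real.norm_eq_abs, abs_of_nonneg h0, ← hJw q.1]
    exact (norm_rpow_le_weight hs le_rfl _).trans (weight_sub_le hs _ _)
  have hlow : ∀ z, 2 * Real.pi * r ^ s ≤ ∫ θ in Set.Ioc 0 (2 * Real.pi), h θ z := by
    intro z
    refine (rpow_le_integral_circleMap hs hr ⟨z i, z j⟩).trans ?_
    rw [← intervalIntegral.integral_of_le hpi.le]
    refine intervalIntegral.integral_mono_on hpi.le ?_ ?_ ?_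
    · exact (((continuous_circleMap 0 r).sub continuous_const).norm.rpow_const
        fun _ => Or.inr hs).intervalIntegrable _ _
    · exact (hcont.comp (by fun_prop : Continuous fun θ : ℝ => (θ, z))).intervalIntegrable _ _
    · intro θ _
      exact Real.rpow_le_rpow (norm_nonneg _) (norm_sub_le_norm_planeEmbedding_sub hij _ z) hs
  have hswap := integral_integral_swap (f := h) hint
  simp_rw [hF] at hswap
  have hfin : 2 * Real.pi * r ^ s ≤ 2 * Real.pi * besselPotential (fun y => ‖y‖ ^ s) x := by
    calc 2 * Real.pi * r ^ s = ∫ z, 2 * Real.pi * r ^ s ∂besselMeasure n := by simp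
      _ ≤ ∫ z, (∫ θ in Set.Ioc 0 (2 * Real.pi), h θ z) ∂besselMeasure n :=
          integral_mono (integrable_const _) hint.integral_prod_right hlow
      _ = _ := by
          rw [← hswap]
          simp [hpi.le]
  exact le_of_mul_le_mul_left hfin hpi

theorem norm_rpow_le_besselPotential (hn : 1 ≤ n) {s : ℝ} (hs : s ∈ JPlus n) (x : Space n) :
    ‖x‖ ^ s ≤ besselPotential (fun y => ‖y‖ ^ s) x := by
  obtain ⟨h0, h1⟩ := hs
  rcases le_or_gt 1 s with h | h
  · exact norm_rpow_le_besselPotential_of_one_le h x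
  rcases h0.eq_or_lt with rfl | hpos
  · simp [besselPotential_eq]
  rcases eq_or_ne x 0 with rfl | hx
  · rw [norm_zero, Real.zero_rpow hpos.ne']
    exact besselPotential_nonneg (fun y => by positivity) 0
  refine norm_rpow_le_besselPotential_of_two_le ?_ h0 hx
  -- For n = 1 and 0 < s < 1 one has s(s-1) < 0, which contradicts membership in `JPlus`.
  by_contra hn2
  have : n = 1 := by omega
  subst this
  norm_num at h1
  nlinarith

/-! ### The time integral of the Bessel potential -/

/-- `∫₀ᵗ 𝓑 f(·, τ) dτ`. -/
def timePotential (f : Space n → ℝ → ℝ) (x : Space n) (t : ℝ) : ℝ :=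
  ∫ τ in (0 : ℝ)..t, besselPotential (fun y => f y τ) x

/-- A jointly measurable function with `0 ≤ f(y, τ) ≤ m(τ) (1 + |y|²)^{a/2}` at positive times. -/
structure TimeGrowth (a : ℝ) (m : ℝ → ℝ) (f : Space n → ℝ → ℝ) : Prop where
  measurable : Measurable (Function.uncurry f)
  nonneg : ∀ y τ, 0 < τ → 0 ≤ f y τ
  le : ∀ y τ, 0 < τ → f y τ ≤ m τ * weight a y

lemma measurable_uncurry_besselPotential {f : Space n → ℝ → ℝ}
    (hf : Measurable (Function.uncurry f)) :
    Measurable fun q : Space n × ℝ => besselPotential (fun y => f y q.2) q.1 := by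
  simp_rw [besselPotential_eq]
  have h : StronglyMeasurable fun q : (Space n × ℝ) × Space n => f (q.1.1 - q.2) q.1.2 :=
    (hf.comp (by fun_prop : Measurable fun q : (Space n × ℝ) × Space n =>
      (q.1.1 - q.2, q.1.2))).stronglyMeasurable
  exact h.integral_prod_right'.measurable

lemma measurable_timePotential {f : Space n → ℝ → ℝ} (hf : Measurable (Function.uncurry f)) :
    Measurable (Function.uncurry (timePotential f)) := by
  have hB := measurable_uncurry_besselPotential hf
  have hg : Measurable fun q : (Space n × ℝ) × ℝ => besselPotential (fun y => f y q.2) q.1.1 :=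
    hB.comp (by fun_prop : Measurable fun q : (Space n × ℝ) × ℝ => (q.1.1, q.2))
  -- An interval integral is the difference of the set integrals over both orientations. Each
  -- becomes an integral over all of ℝ of a jointly measurable indicator.
  have key : ∀ l r : Space n × ℝ → ℝ, Measurable l → Measurable r → Measurable
      fun q : Space n × ℝ => ∫ τ in Set.Ioc (l q) (r q), besselPotential (fun y => f y τ) q.1 := by
    intro l r hl hr
    have hS : MeasurableSet {q : (Space n × ℝ) × ℝ | l q.1 < q.2 ∧ q.2 ≤ r q.1} :=
      (measurableSet_lt (hl.comp measurable_fst) measurable_snd).inter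
        (measurableSet_le measurable_snd (hr.comp measurable_fst))
    have h := ((hg.indicator hS).stronglyMeasurable.integral_prod_right'
      (ν := (volume : Measure ℝ))).measurable
    convert! h using 2
    rw [← integral_indicator measurableSet_Ioc]
    rfl
  have h1 := key (fun _ => 0) (fun q => q.2) measurable_const measurable_snd
  have h2 := key (fun q => q.2) (fun _ => 0) measurable_snd measurable_const
  exact h1.sub h2

section

variable {a : ℝ} {m : ℝ → ℝ} {f : Space n → ℝ → ℝ}

lemma TimeGrowth.measurable_slice (hf : TimeGrowth a m f) (τ : ℝ) : Measurable fun y => f y τ :=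
  hf.measurable.comp (by fun_prop : Measurable fun y : Space n => (y, τ))

lemma TimeGrowth.abs_le (hf : TimeGrowth a m f) (y : Space n) {τ : ℝ} (hτ : 0 < τ) :
    |f y τ| ≤ m τ * weight a y :=
  (abs_of_nonneg (hf.nonneg y τ hτ)).trans_le (hf.le y τ hτ)

lemma TimeGrowth.besselPotential_le (ha : 0 ≤ a) (hf : TimeGrowth a m f) (x : Space n) {τ : ℝ}
    (hτ : 0 < τ) : besselPotential (fun y => f y τ) x ≤ m τ * (besselConst n a * weight a x) :=
  Pseudoparabolic.besselPotential_le ha (fun y => hf.nonneg y τ hτ) (fun y => hf.le y τ hτ) x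

lemma TimeGrowth.besselPotential_nonneg (hf : TimeGrowth a m f) (x : Space n) {τ : ℝ}
    (hτ : 0 < τ) : 0 ≤ besselPotential (fun y => f y τ) x :=
  Pseudoparabolic.besselPotential_nonneg (fun y => hf.nonneg y τ hτ) x

lemma pos_of_mem_uIoc {s t τ : ℝ} (hs : 0 ≤ s) (ht : 0 ≤ t) (hτ : τ ∈ Set.uIoc s t) : 0 < τ :=
  (le_min hs ht).trans_lt hτ.1

lemma TimeGrowth.norm_besselPotential_le (ha : 0 ≤ a) (hf : TimeGrowth a m f) (x : Space n)
    {s t : ℝ} (hs : 0 ≤ s) (ht : 0 ≤ t) : ∀ᵐ τ ∂volume.restrict (Set.uIoc s t),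
      ‖besselPotential (fun y => f y τ) x‖ ≤ m τ * (besselConst n a * weight a x) := by
  refine (ae_restrict_mem measurableSet_uIoc).mono fun τ hτ => ?_
  have hp := pos_of_mem_uIoc hs ht hτ
  rw [Real.norm_eq_abs, abs_of_nonneg (hf.besselPotential_nonneg x hp)]
  exact hf.besselPotential_le ha x hp

lemma TimeGrowth.intervalIntegrable (ha : 0 ≤ a) (hm : Continuous m) (hf : TimeGrowth a m f)
    (x : Space n) {s t : ℝ} (hs : 0 ≤ s) (ht : 0 ≤ t) :
    IntervalIntegrable (fun τ => besselPotential (fun y => f y τ) x) volume s t := by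
  refine IntervalIntegrable.mono_fun'
    ((hm.mul continuous_const).intervalIntegrable s t)
    ((measurable_uncurry_besselPotential hf.measurable).comp
      (by fun_prop : Measurable fun τ : ℝ => (x, τ))).aestronglyMeasurable
    (hf.norm_besselPotential_le ha x hs ht)

lemma timePotential_nonneg {t : ℝ} (ht : 0 ≤ t) (h : ∀ y τ, 0 < τ → τ ≤ t → 0 ≤ f y τ)
    (x : Space n) : 0 ≤ timePotential f x t := by
  unfold timePotential
  rw [intervalIntegral.integral_of_le ht]
  exact setIntegral_nonneg measurableSet_Ioc fun τ hτ =>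
    besselPotential_nonneg (fun y => h y τ hτ.1 hτ.2) x

lemma timePotential_mono {g : Space n → ℝ → ℝ} (ha : 0 ≤ a) (hm : Continuous m)
    (hg : TimeGrowth a m g) {t : ℝ} (ht : 0 ≤ t) (h0 : ∀ y τ, 0 < τ → τ ≤ t → 0 ≤ f y τ)
    (h : ∀ y τ, 0 < τ → τ ≤ t → f y τ ≤ g y τ) (x : Space n) :
    timePotential f x t ≤ timePotential g x t := by
  unfold timePotential
  rw [intervalIntegral.integral_of_le ht, intervalIntegral.integral_of_le ht]
  refine integral_mono_of_nonneg ?_ (hg.intervalIntegrable ha hm x le_rfl ht).1 ?_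
  · exact (ae_restrict_mem measurableSet_Ioc).mono fun τ hτ =>
      besselPotential_nonneg (fun y => h0 y τ hτ.1 hτ.2) x
  · exact (ae_restrict_mem measurableSet_Ioc).mono fun τ hτ =>
      besselPotential_mono ha (fun y => h0 y τ hτ.1 hτ.2) (fun y => h y τ hτ.1 hτ.2)
        (hg.measurable_slice τ) (fun y => hg.abs_le y hτ.1) x

/-- After division by the weight the bound is uniform in x, which later gives continuity in time for
the weighted norm. -/
lemma TimeGrowth.abs_timePotential_sub_le (ha : 0 ≤ a) (hm : Continuous m)
    (hf : TimeGrowth a m f) (x : Space n) {s t : ℝ} (hs : 0 ≤ s) (ht : 0 ≤ t) :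
    |timePotential f x t - timePotential f x s| ≤
      |∫ τ in s..t, m τ| * (besselConst n a * weight a x) := by
  have h0 := fun {r : ℝ} (hr : 0 ≤ r) => hf.intervalIntegrable ha hm x le_rfl hr
  unfold timePotential
  rw [intervalIntegral.integral_interval_sub_left (h0 ht) (h0 hs)]
  have hK : 0 ≤ besselConst n a * weight a x :=
    mul_nonneg (besselConst_nonneg a) (weight_pos a x).le
  have h := intervalIntegral.norm_integral_le_abs_of_norm_le
    (hf.norm_besselPotential_le ha x hs ht)
    ((hm.mul continuous_const).intervalIntegrable s t)
  rwa [intervalIntegral.integral_mul_const, abs_mul, abs_of_nonneg hK, Real.norm_eq_abs] at h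

lemma timePotential_zero (f : Space n → ℝ → ℝ) (x : Space n) : timePotential f x 0 = 0 := by
  simp [timePotential]

lemma TimeGrowth.timePotential_le (ha : 0 ≤ a) (hm : Continuous m) (hm0 : ∀ t, 0 ≤ m t)
    (hf : TimeGrowth a m f) (x : Space n) {t : ℝ} (ht : 0 ≤ t) :
    timePotential f x t ≤ (∫ τ in (0 : ℝ)..t, m τ) * (besselConst n a * weight a x) := by
  have h := (le_abs_self _).trans (hf.abs_timePotential_sub_le ha hm x le_rfl ht)
  rwa [timePotential_zero, sub_zero,
    abs_of_nonneg (intervalIntegral.integral_nonneg ht fun τ _ => hm0 τ)] at h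

lemma TimeGrowth.continuous_timePotential (ha : 0 ≤ a) (hm : Continuous m)
    (hf : TimeGrowth a m f) {t : ℝ} (ht : 0 ≤ t) : Continuous fun x => timePotential f x t := by
  rw [continuous_iff_continuousAt]
  intro x₀
  have hw : ∀ᶠ x in 𝓝 x₀, weight a x < weight a x₀ + 1 :=
    (continuous_weight a).continuousAt.eventually (gt_mem_nhds (lt_add_one _))
  refine intervalIntegral.continuousAt_of_dominated_interval
    (bound := fun τ => m τ * (besselConst n a * (weight a x₀ + 1))) ?_ ?_ ?_ ?_
  · exact Eventually.of_forall fun x => ((measurable_uncurry_besselPotential hf.measurable).comp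
      (by fun_prop : Measurable fun τ : ℝ => (x, τ))).aestronglyMeasurable
  · filter_upwards [hw] with x hx
    refine ae_of_all _ fun τ hτ => ?_
    have hp := pos_of_mem_uIoc le_rfl ht hτ
    rw [Real.norm_eq_abs, abs_of_nonneg (hf.besselPotential_nonneg x hp)]
    have hmτ : 0 ≤ m τ :=
      nonneg_of_mul_nonneg_left ((hf.nonneg x τ hp).trans (hf.le x τ hp)) (weight_pos a x)
    exact (hf.besselPotential_le ha x hp).trans (mul_le_mul_of_nonneg_left
      (mul_le_mul_of_nonneg_left hx.le (besselConst_nonneg a)) hmτ)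
  · exact (hm.mul continuous_const).intervalIntegrable _ _
  · refine ae_of_all _ fun τ hτ => ?_
    have hp := pos_of_mem_uIoc le_rfl ht hτ
    exact (continuous_besselPotential ha (hf.measurable_slice τ) (fun y => hf.nonneg y τ hp)
      (fun y => hf.le y τ hp)).continuousAt

lemma tendsto_timePotential {F : ℕ → Space n → ℝ → ℝ} (ha : 0 ≤ a) (hm : Continuous m)
    (hF : ∀ k, TimeGrowth a m (F k)) {t : ℝ} (ht : 0 ≤ t)
    (hlim : ∀ y τ, 0 < τ → Tendsto (fun k => F k y τ) atTop (𝓝 (f y τ))) (x : Space n) :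
    Tendsto (fun k => timePotential (F k) x t) atTop (𝓝 (timePotential f x t)) := by
  refine intervalIntegral.tendsto_integral_filter_of_dominated_convergence
    (fun τ => m τ * (besselConst n a * weight a x)) ?_ ?_ ?_ ?_
  · exact Eventually.of_forall fun k =>
      ((measurable_uncurry_besselPotential (hF k).measurable).comp
        (by fun_prop : Measurable fun τ : ℝ => (x, τ))).aestronglyMeasurable
  · refine Eventually.of_forall fun k => ae_of_all _ fun τ hτ => ?_
    have hp := pos_of_mem_uIoc le_rfl ht hτ
    rw [Real.norm_eq_abs, abs_of_nonneg ((hF k).besselPotential_nonneg x hp)]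
    exact (hF k).besselPotential_le ha x hp
  · exact (hm.mul continuous_const).intervalIntegrable _ _
  · refine ae_of_all _ fun τ hτ => ?_
    have hp := pos_of_mem_uIoc le_rfl ht hτ
    simp_rw [besselPotential_eq]
    refine tendsto_integral_of_dominated_convergence
      (fun z => m τ * (2 ^ (a / 2) * weight a x * weight a z)) ?_ ?_ ?_ ?_
    · exact fun k => (((hF k).measurable_slice τ).comp
        (measurable_const.sub measurable_id)).aestronglyMeasurable
    · exact ((integrable_weight ha).const_mul _).const_mul _
    · refine fun k => ae_of_all _ fun z => ?_
      have hmτ : 0 ≤ m τ := nonneg_of_mul_nonneg_left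
        (((hF k).nonneg x τ hp).trans ((hF k).le x τ hp)) (weight_pos a x)
      exact ((hF k).abs_le _ hp).trans (mul_le_mul_of_nonneg_left (weight_sub_le ha x z) hmτ)
    · exact ae_of_all _ fun z => hlim _ τ hp

end

/-! ### The fixed point operator and its barrier -/

/-- The integrand `e^{(1-p)τ} V μ^p` of the nonlinear term. -/
def source (p : ℝ) (V μ : Space n → ℝ → ℝ) (y : Space n) (τ : ℝ) : ℝ :=
  Real.exp ((1 - p) * τ) * (V y τ * μ y τ ^ p)

lemma Ms_eq (p : ℝ) (V μ : Space n → ℝ → ℝ) (x : Space n) (t : ℝ) :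
    Ms p (fun _ => 0) V μ x t = timePotential μ x t + timePotential (source p V μ) x t := by
  unfold Ms timePotential source
  simp_rw [besselPotential_const_mul, zero_add]

lemma Ms_congr {p : ℝ} {u₀ : Space n → ℝ} {V V' : Space n → ℝ → ℝ}
    (h : ∀ y τ, 0 < τ → V y τ = V' y τ) (μ : Space n → ℝ → ℝ) (x : Space n) {t : ℝ} (ht : 0 ≤ t) :
    Ms p u₀ V μ x t = Ms p u₀ V' μ x t := by
  unfold Ms
  congr 1
  refine intervalIntegral.integral_congr_ae (ae_of_all _ fun τ hτ => ?_)
  have hp := pos_of_mem_uIoc le_rfl ht hτ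
  simp_rw [h _ τ hp]

/-- A jointly measurable potential with `0 ≤ V(x, t) ≤ Λ(t) |x|^σ` at positive times. -/
structure PowerBound (σ : ℝ) (Λ : ℝ → ℝ) (V : Space n → ℝ → ℝ) : Prop where
  measurable : Measurable (Function.uncurry V)
  continuous : Continuous Λ
  coeff_nonneg : ∀ t, 0 ≤ Λ t
  nonneg : ∀ x t, 0 < t → 0 ≤ V x t
  le : ∀ x t, 0 < t → V x t ≤ Λ t * ‖x‖ ^ σ

lemma weight_mono {a b : ℝ} (h : a ≤ b) (x : Space n) : weight a x ≤ weight b x :=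
  Real.rpow_le_rpow_of_exponent_le (by nlinarith [sq_nonneg ‖x‖]) (by linarith)

lemma weight_mul_rpow_weight (σ a p : ℝ) (x : Space n) :
    weight σ x * weight a x ^ p = weight (σ + a * p) x := by
  unfold weight
  rw [← Real.rpow_mul (by positivity), ← Real.rpow_add (by positivity)]
  congr 1; ring

section

variable {p σ a : ℝ} {Λ m : ℝ → ℝ} {V μ ν : Space n → ℝ → ℝ}

/-- Two facts make the nonlinear term grow at most linearly: σ + ap ≤ a, a restatement of a ≥
σ/(1-p), and m^p ≤ m, which is why m ≥ 1 is required. -/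
lemma TimeGrowth.source (hp0 : 0 < p) (hp1 : p < 1) (hσ : 0 ≤ σ) (ha : σ / (1 - p) ≤ a)
    (hV : PowerBound σ Λ V) (hm1 : ∀ τ, 0 < τ → 1 ≤ m τ) (hμ : TimeGrowth a m μ) :
    TimeGrowth a (fun τ => Real.exp ((1 - p) * τ) * Λ τ * m τ) (source p V μ) where
  measurable := by
    have h1 := hV.measurable
    have h2 := hμ.measurable.pow_const p
    unfold Function.uncurry Pseudoparabolic.source at *
    fun_prop
  nonneg y τ hτ := by
    have h1 := hV.nonneg y τ hτ
    have h2 := hμ.nonneg y τ hτ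
    unfold Pseudoparabolic.source
    positivity
  le y τ hτ := by
    have h1 := hV.nonneg y τ hτ
    have h2 := hμ.nonneg y τ hτ
    have hm := hm1 τ hτ
    have hm0 : 0 ≤ m τ := zero_le_one.trans hm
    have hw := weight_pos a y
    have hwσ := weight_pos σ y
    have hΛ := hV.coeff_nonneg τ
    have hexp : σ + a * p ≤ a := by
      rw [div_le_iff₀ (by linarith)] at ha
      linarith
    unfold Pseudoparabolic.source
    rw [mul_assoc, mul_assoc]
    refine mul_le_mul_of_nonneg_left ?_ (Real.exp_pos _).le
    calc V y τ * μ y τ ^ p ≤ (Λ τ * weight σ y) * (m τ * weight a y) ^ p := by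
          have h3 : V y τ ≤ Λ τ * weight σ y := (hV.le y τ hτ).trans
            (mul_le_mul_of_nonneg_left (norm_rpow_le_weight hσ le_rfl y) hΛ)
          have h4 := hμ.le y τ hτ
          gcongr
      _ = Λ τ * (m τ ^ p * (weight σ y * weight a y ^ p)) := by
          rw [Real.mul_rpow hm0 hw.le]; ring
      _ ≤ Λ τ * (m τ * weight a y) := by
          rw [weight_mul_rpow_weight]
          have h5 : m τ ^ p ≤ m τ := by
            simpa using Real.rpow_le_rpow_of_exponent_le hm hp1.le
          have h6 := weight_mono hexp y
          have h7 := weight_pos (σ + a * p) y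
          gcongr
      _ = _ := by ring

lemma nonneg_of_div_le (hp1 : p < 1) (hσ : 0 ≤ σ) (ha : σ / (1 - p) ≤ a) : 0 ≤ a :=
  (div_nonneg hσ (by linarith)).trans ha

lemma Ms_nonneg (hV : PowerBound σ Λ V) {t : ℝ} (ht : 0 ≤ t)
    (h0 : ∀ y τ, 0 < τ → τ ≤ t → 0 ≤ μ y τ) (x : Space n) : 0 ≤ Ms p (fun _ => 0) V μ x t := by
  rw [Ms_eq]
  refine add_nonneg (timePotential_nonneg ht h0 x) (timePotential_nonneg ht (fun y τ h1 h2 => ?_) x)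
  have := hV.nonneg y τ h1
  have := h0 y τ h1 h2
  unfold source
  positivity

lemma continuous_sourceCoeff (hV : PowerBound σ Λ V) (hm : Continuous m) :
    Continuous fun τ => Real.exp ((1 - p) * τ) * Λ τ * m τ := by
  have := hV.continuous
  fun_prop

/-- Positivity of 𝓑 and monotonicity of u ↦ u^p. Only the larger function must be measurable with
controlled growth; the smaller one need only be nonnegative. -/
lemma Ms_mono (hp0 : 0 < p) (hp1 : p < 1) (hσ : 0 ≤ σ) (ha : σ / (1 - p) ≤ a)
    (hV : PowerBound σ Λ V) (hm : Continuous m) (hm1 : ∀ τ, 0 < τ → 1 ≤ m τ)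
    (hν : TimeGrowth a m ν) {t : ℝ} (ht : 0 ≤ t) (h0 : ∀ y τ, 0 < τ → τ ≤ t → 0 ≤ μ y τ)
    (h : ∀ y τ, 0 < τ → τ ≤ t → μ y τ ≤ ν y τ) (x : Space n) :
    Ms p (fun _ => 0) V μ x t ≤ Ms p (fun _ => 0) V ν x t := by
  have ha0 := nonneg_of_div_le hp1 hσ ha
  rw [Ms_eq, Ms_eq]
  refine add_le_add (timePotential_mono ha0 hm hν ht h0 h x)
    (timePotential_mono ha0 (continuous_sourceCoeff hV hm) (hν.source hp0 hp1 hσ ha hV hm1) ht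
      (fun y τ h1 h2 => ?_) (fun y τ h1 h2 => ?_) x)
  · have := hV.nonneg y τ h1
    have := h0 y τ h1 h2
    unfold source
    positivity
  · have h3 := hV.nonneg y τ h1
    have h4 := h0 y τ h1 h2
    have h5 := h y τ h1 h2
    unfold source
    gcongr

/-- The growth rate of the barrier. -/
def barrierRate (n : ℕ) (p a : ℝ) (Λ : ℝ → ℝ) (τ : ℝ) : ℝ :=
  2 * besselConst n a * (1 + Real.exp ((1 - p) * τ) * Λ τ)

/-- The time factor of the barrier. -/
def barrier (n : ℕ) (p a : ℝ) (Λ : ℝ → ℝ) (t : ℝ) : ℝ :=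
  Real.exp (∫ τ in (0 : ℝ)..t, barrierRate n p a Λ τ)

lemma barrier_pos (t : ℝ) : 0 < barrier n p a Λ t := Real.exp_pos _

lemma continuous_barrierRate (hV : PowerBound σ Λ V) : Continuous (barrierRate n p a Λ) := by
  have := hV.continuous
  unfold barrierRate
  fun_prop

lemma barrierRate_nonneg (hV : PowerBound σ Λ V) (t : ℝ) : 0 ≤ barrierRate n p a Λ t := by
  have := hV.coeff_nonneg t
  have := besselConst_nonneg (n := n) a
  unfold barrierRate
  positivity

lemma hasDerivAt_barrier (hV : PowerBound σ Λ V) (t : ℝ) :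
    HasDerivAt (barrier n p a Λ) (barrier n p a Λ t * barrierRate n p a Λ t) t :=
  ((continuous_barrierRate hV).integral_hasStrictDerivAt 0 t).hasDerivAt.exp

lemma continuous_barrier (hV : PowerBound σ Λ V) : Continuous (barrier n p a Λ) :=
  continuous_iff_continuousAt.2 fun t => (hasDerivAt_barrier hV t).continuousAt

lemma one_le_barrier (hV : PowerBound σ Λ V) {t : ℝ} (ht : 0 ≤ t) : 1 ≤ barrier n p a Λ t :=
  Real.one_le_exp (intervalIntegral.integral_nonneg ht fun τ _ => barrierRate_nonneg hV τ)

lemma timeGrowth_barrier (hV : PowerBound σ Λ V) {A : ℝ} (hA : 0 ≤ A) :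
    TimeGrowth (n := n) a (fun τ => A * barrier n p a Λ τ)
      (fun y τ => A * barrier n p a Λ τ * weight a y) where
  measurable := by
    have h1 := (continuous_barrier (n := n) (p := p) (a := a) hV).measurable
    have h2 := (continuous_weight (n := n) a).measurable
    unfold Function.uncurry
    fun_prop
  nonneg y τ _ := mul_nonneg (mul_nonneg hA (barrier_pos τ).le) (weight_pos a y).le
  le y τ _ := le_rfl

/-- Multiples of the barrier are halved by the operator. -/
lemma Ms_le_barrier (hp0 : 0 < p) (hp1 : p < 1) (hσ : 0 ≤ σ) (ha : σ / (1 - p) ≤ a)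
    (hV : PowerBound σ Λ V) {A : ℝ} (hA : 1 ≤ A) {t : ℝ} (ht : 0 ≤ t)
    (h0 : ∀ y τ, 0 < τ → τ ≤ t → 0 ≤ μ y τ)
    (h : ∀ y τ, 0 < τ → τ ≤ t → μ y τ ≤ A * barrier n p a Λ τ * weight a y) (x : Space n) :
    Ms p (fun _ => 0) V μ x t ≤ A / 2 * barrier n p a Λ t * weight a x := by
  have ha0 := nonneg_of_div_le hp1 hσ ha
  have hA0 : 0 ≤ A := zero_le_one.trans hA
  set M := barrier n p a Λ with hM
  have hMc : Continuous M := continuous_barrier hV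
  have hM0 : ∀ τ, 0 ≤ M τ := fun τ => (barrier_pos τ).le
  have hm : Continuous fun τ => A * M τ := continuous_const.mul hMc
  have hm1 : ∀ τ, 0 < τ → 1 ≤ A * M τ := fun τ hτ =>
    one_le_mul_of_one_le_of_one_le hA (one_le_barrier hV hτ.le)
  have hG := timeGrowth_barrier (p := p) (a := a) hV hA0
  refine (Ms_mono hp0 hp1 hσ ha hV hm hm1 hG ht h0 h x).trans ?_
  rw [Ms_eq]
  have h1 := hG.timePotential_le ha0 hm (fun τ => mul_nonneg hA0 (hM0 τ)) x ht
  have h2 := (hG.source hp0 hp1 hσ ha hV hm1).timePotential_le ha0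
    (continuous_sourceCoeff hV hm) (fun τ => mul_nonneg (mul_nonneg (Real.exp_pos _).le
      (hV.coeff_nonneg τ)) (mul_nonneg hA0 (hM0 τ))) x ht
  refine (add_le_add h1 h2).trans ?_
  -- M solves M' = M·rate with M(0) = 1. The factor 2 in the rate produces the factor 1/2 in the
  -- conclusion.
  have hint : (∫ τ in (0 : ℝ)..t, M τ * barrierRate n p a Λ τ) = M t - 1 := by
    rw [intervalIntegral.integral_eq_sub_of_hasDerivAt (fun τ _ => hasDerivAt_barrier hV τ)
      ((hMc.mul (continuous_barrierRate hV)).intervalIntegrable _ _), ← hM]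
    congr 1
    simp [hM, barrier]
  have hsum : ((∫ τ in (0 : ℝ)..t, A * M τ) +
      ∫ τ in (0 : ℝ)..t, Real.exp ((1 - p) * τ) * Λ τ * (A * M τ)) * besselConst n a =
      A / 2 * (M t - 1) := by
    rw [← hint, ← intervalIntegral.integral_add (hm.intervalIntegrable _ _)
      ((continuous_sourceCoeff hV hm).intervalIntegrable _ _),
      ← intervalIntegral.integral_mul_const, ← intervalIntegral.integral_const_mul]
    congr 1
    ext τ
    unfold barrierRate
    ring
  rw [← add_mul, ← mul_assoc, hsum]
  refine mul_le_mul_of_nonneg_right ?_ (weight_pos a x).le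
  exact mul_le_mul_of_nonneg_left (by linarith) (by linarith)

/-- Subsolutions of polynomial growth lie below the barrier. -/
theorem le_barrier_of_le_Ms (hp0 : 0 < p) (hp1 : p < 1) (hσ : 0 ≤ σ) (ha : σ / (1 - p) ≤ a)
    (hV : PowerBound σ Λ V) (h0 : ∀ y τ, 0 ≤ τ → 0 ≤ μ y τ)
    (h : ∀ y τ, 0 ≤ τ → μ y τ ≤ Ms p (fun _ => 0) V μ y τ)
    (hb : ∀ T, ∃ A, ∀ y τ, 0 ≤ τ → τ ≤ T → μ y τ ≤ A * weight a y) (x : Space n) {t : ℝ}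
    (ht : 0 ≤ t) : μ x t ≤ barrier n p a Λ t * weight a x := by
  obtain ⟨A, hA⟩ := hb t
  -- The floor 1 is kept because the halving step requires a factor of at least 1.
  have key : ∀ k : ℕ, ∀ y τ, 0 ≤ τ → τ ≤ t →
      μ y τ ≤ max (A / 2 ^ k) 1 * barrier n p a Λ τ * weight a y := by
    intro k
    induction k with
    | zero =>
      intro y τ h1 h2
      refine (hA y τ h1 h2).trans (mul_le_mul_of_nonneg_right ?_ (weight_pos a y).le)
      rw [pow_zero, div_one]
      calc A ≤ max A 1 * 1 := by rw [mul_one]; exact le_max_left _ _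
        _ ≤ _ := mul_le_mul_of_nonneg_left (one_le_barrier hV h1)
          (zero_le_one.trans (le_max_right _ _))
    | succ k ih =>
      intro y τ h1 h2
      refine (h y τ h1).trans ((Ms_le_barrier hp0 hp1 hσ ha hV (le_max_right _ _) h1
        (fun z s hs _ => h0 z s hs.le)
        (fun z s hs hs2 => ih z s hs.le (hs2.trans h2)) y).trans ?_)
      refine mul_le_mul_of_nonneg_right (mul_le_mul_of_nonneg_right ?_ (barrier_pos τ).le)
        (weight_pos a y).le
      rcases max_cases (A / 2 ^ k) 1 with hk | hk
      · rw [hk.1, pow_succ, ← div_div]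
        exact le_max_left _ _
      · rw [hk.1]
        exact le_trans (by norm_num) (le_max_right _ _)
  obtain ⟨k, hk⟩ := pow_unbounded_of_one_lt A (one_lt_two : (1 : ℝ) < 2)
  have hmax : max (A / 2 ^ k) 1 = 1 := max_eq_right ((div_le_one (by positivity)).2 hk.le)
  have := key k x t ht le_rfl
  rwa [hmax, one_mul] at this

/-! ### Monotone iteration from the barrier -/

/-- The iterates of the fixed point operator, starting from the barrier. -/
def iterate (p a : ℝ) (Λ : ℝ → ℝ) (V : Space n → ℝ → ℝ) : ℕ → Space n → ℝ → ℝ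
  | 0 => fun y τ => barrier n p a Λ τ * weight a y
  | k + 1 => fun y τ => Ms p (fun _ => 0) V (iterate p a Λ V k) y τ

lemma iterate_props (hp0 : 0 < p) (hp1 : p < 1) (hσ : 0 ≤ σ) (ha : σ / (1 - p) ≤ a)
    (hV : PowerBound σ Λ V) (k : ℕ) :
    Measurable (Function.uncurry (iterate p a Λ V k)) ∧
    ∀ y τ, 0 ≤ τ → 0 ≤ iterate p a Λ V k y τ ∧
      iterate p a Λ V k y τ ≤ barrier n p a Λ τ * weight a y := by
  induction k with
  | zero =>
    refine ⟨?_, fun y τ _ => ⟨mul_nonneg (barrier_pos τ).le (weight_pos a y).le, le_rfl⟩⟩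
    have h1 := (continuous_barrier (n := n) (p := p) (a := a) hV).measurable
    have h2 := (continuous_weight (n := n) a).measurable
    unfold Function.uncurry iterate
    fun_prop
  | succ k ih =>
    obtain ⟨ihm, ihb⟩ := ih
    refine ⟨?_, fun y τ hτ => ⟨Ms_nonneg hV hτ (fun z s hs _ => (ihb z s hs.le).1) y, ?_⟩⟩
    · have hs : Measurable (Function.uncurry (source p V (iterate p a Λ V k))) := by
        have h1 := hV.measurable
        have h2 := ihm.pow_const p
        unfold Function.uncurry source at *
        fun_prop
      have := (measurable_timePotential ihm).add (measurable_timePotential hs)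
      convert! this using 1
      ext q
      exact Ms_eq _ _ _ _ _
    · have := Ms_le_barrier hp0 hp1 hσ ha hV le_rfl hτ (fun z s hs _ => (ihb z s hs.le).1)
        (fun z s hs _ => by rw [one_mul]; exact (ihb z s hs.le).2) y
      refine this.trans (mul_le_mul_of_nonneg_right ?_ (weight_pos a y).le)
      have := barrier_pos (n := n) (p := p) (a := a) (Λ := Λ) τ
      linarith

lemma timeGrowth_iterate (hp0 : 0 < p) (hp1 : p < 1) (hσ : 0 ≤ σ) (ha : σ / (1 - p) ≤ a)
    (hV : PowerBound σ Λ V) (k : ℕ) :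
    TimeGrowth a (barrier n p a Λ) (iterate p a Λ V k) where
  measurable := (iterate_props hp0 hp1 hσ ha hV k).1
  nonneg y τ hτ := ((iterate_props hp0 hp1 hσ ha hV k).2 y τ hτ.le).1
  le y τ hτ := ((iterate_props hp0 hp1 hσ ha hV k).2 y τ hτ.le).2

lemma iterate_succ_le (hp0 : 0 < p) (hp1 : p < 1) (hσ : 0 ≤ σ) (ha : σ / (1 - p) ≤ a)
    (hV : PowerBound σ Λ V) (k : ℕ) : ∀ (y : Space n) (τ : ℝ), 0 ≤ τ →
      iterate p a Λ V (k + 1) y τ ≤ iterate p a Λ V k y τ := by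
  induction k with
  | zero => exact fun y τ hτ => ((iterate_props hp0 hp1 hσ ha hV 1).2 y τ hτ).2
  | succ k ih =>
    intro y τ hτ
    exact Ms_mono hp0 hp1 hσ ha hV (continuous_barrier hV) (fun s hs => one_le_barrier hV hs.le)
      (timeGrowth_iterate hp0 hp1 hσ ha hV k) hτ
      (fun z s hs _ => ((iterate_props hp0 hp1 hσ ha hV (k + 1)).2 z s hs.le).1)
      (fun z s hs _ => ih z s hs.le) y

/-- Comparison with the barrier starts the induction, and monotonicity of the operator carries it
on. -/
lemma le_iterate_of_le_Ms (hp0 : 0 < p) (hp1 : p < 1) (hσ : 0 ≤ σ) (ha : σ / (1 - p) ≤ a)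
    (hV : PowerBound σ Λ V) (h0 : ∀ y τ, 0 ≤ τ → 0 ≤ μ y τ)
    (h : ∀ y τ, 0 ≤ τ → μ y τ ≤ Ms p (fun _ => 0) V μ y τ)
    (hb : ∀ T, ∃ A, ∀ y τ, 0 ≤ τ → τ ≤ T → μ y τ ≤ A * weight a y) (k : ℕ) :
    ∀ (y : Space n) (τ : ℝ), 0 ≤ τ → μ y τ ≤ iterate p a Λ V k y τ := by
  induction k with
  | zero => exact fun y τ hτ => le_barrier_of_le_Ms hp0 hp1 hσ ha hV h0 h hb y hτ
  | succ k ih =>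
    intro y τ hτ
    exact (h y τ hτ).trans (Ms_mono hp0 hp1 hσ ha hV (continuous_barrier hV)
      (fun s hs => one_le_barrier hV hs.le) (timeGrowth_iterate hp0 hp1 hσ ha hV k) hτ
      (fun z s hs _ => h0 z s hs.le) (fun z s hs _ => ih z s hs.le) y)

/-- The limit of the monotone iteration. -/
def iterateLimit (p a : ℝ) (Λ : ℝ → ℝ) (V : Space n → ℝ → ℝ) (y : Space n) (τ : ℝ) : ℝ :=
  -- Clamping time at 0 makes the sequence antitone and bounded below for every real τ, so the limit
  -- is measurable on all of space-time.
  ⨅ k, iterate p a Λ V k y (max τ 0)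

lemma tendsto_iterate (hp0 : 0 < p) (hp1 : p < 1) (hσ : 0 ≤ σ) (ha : σ / (1 - p) ≤ a)
    (hV : PowerBound σ Λ V) (y : Space n) (τ : ℝ) :
    Tendsto (fun k => iterate p a Λ V k y (max τ 0)) atTop (𝓝 (iterateLimit p a Λ V y τ)) := by
  refine tendsto_atTop_ciInf (antitone_nat_of_succ_le fun k => ?_) ⟨0, ?_⟩
  · exact iterate_succ_le hp0 hp1 hσ ha hV k y _ (le_max_right _ _)
  · rintro _ ⟨k, rfl⟩
    exact ((iterate_props hp0 hp1 hσ ha hV k).2 y _ (le_max_right _ _)).1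

lemma tendsto_iterate_of_nonneg (hp0 : 0 < p) (hp1 : p < 1) (hσ : 0 ≤ σ) (ha : σ / (1 - p) ≤ a)
    (hV : PowerBound σ Λ V) (y : Space n) {τ : ℝ} (hτ : 0 ≤ τ) :
    Tendsto (fun k => iterate p a Λ V k y τ) atTop (𝓝 (iterateLimit p a Λ V y τ)) := by
  have := tendsto_iterate hp0 hp1 hσ ha hV y τ
  rwa [max_eq_left hτ] at this

lemma timeGrowth_iterateLimit (hp0 : 0 < p) (hp1 : p < 1) (hσ : 0 ≤ σ) (ha : σ / (1 - p) ≤ a)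
    (hV : PowerBound σ Λ V) : TimeGrowth a (barrier n p a Λ) (iterateLimit p a Λ V) where
  measurable := by
    refine measurable_of_tendsto_metrizable (f := fun k => fun q : Space n × ℝ =>
      iterate p a Λ V k q.1 (max q.2 0)) (fun k => ?_) ?_
    · exact (iterate_props hp0 hp1 hσ ha hV k).1.comp
        (by fun_prop : Measurable fun q : Space n × ℝ => (q.1, max q.2 0))
    · exact tendsto_pi_nhds.2 fun q => tendsto_iterate hp0 hp1 hσ ha hV q.1 q.2
  nonneg y τ hτ := ge_of_tendsto' (tendsto_iterate_of_nonneg hp0 hp1 hσ ha hV y hτ.le) fun k =>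
    ((iterate_props hp0 hp1 hσ ha hV k).2 y τ hτ.le).1
  le y τ hτ := le_of_tendsto' (tendsto_iterate_of_nonneg hp0 hp1 hσ ha hV y hτ.le) fun k =>
    ((iterate_props hp0 hp1 hσ ha hV k).2 y τ hτ.le).2

/-- Dominated convergence under the barrier, applied to the linear and nonlinear terms separately;
the left side is the same sequence shifted by one. -/
theorem iterateLimit_eq_Ms (hp0 : 0 < p) (hp1 : p < 1) (hσ : 0 ≤ σ) (ha : σ / (1 - p) ≤ a)
    (hV : PowerBound σ Λ V) (x : Space n) {t : ℝ} (ht : 0 ≤ t) :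
    iterateLimit p a Λ V x t = Ms p (fun _ => 0) V (iterateLimit p a Λ V) x t := by
  have ha0 := nonneg_of_div_le hp1 hσ ha
  have hMc := continuous_barrier (n := n) (p := p) (a := a) hV
  have hM1 : ∀ τ, 0 < τ → 1 ≤ barrier n p a Λ τ := fun τ hτ => one_le_barrier hV hτ.le
  have hlim := fun y (τ : ℝ) (hτ : 0 < τ) => tendsto_iterate_of_nonneg hp0 hp1 hσ ha hV y hτ.le
  have h1 := tendsto_timePotential ha0 hMc (timeGrowth_iterate hp0 hp1 hσ ha hV) ht hlim x
  have h2 := tendsto_timePotential (f := source p V (iterateLimit p a Λ V)) ha0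
    (continuous_sourceCoeff (p := p) hV hMc)
    (fun k => (timeGrowth_iterate hp0 hp1 hσ ha hV k).source hp0 hp1 hσ ha hV hM1) ht
    (fun y τ hτ => (((hlim y τ hτ).rpow_const (Or.inr hp0.le)).const_mul _).const_mul _) x
  have h3 := (tendsto_iterate_of_nonneg hp0 hp1 hσ ha hV x ht).comp (tendsto_add_atTop_nat 1)
  rw [Ms_eq]
  refine tendsto_nhds_unique h3 ((h1.add h2).congr fun k => ?_)
  exact (Ms_eq _ _ _ _ _).symm

end

/-! ### The spaces `BC` and `ZInfty` -/

lemma rpow_neg_mul_weight (a : ℝ) (x : Space n) :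
    (1 ^ 2 + ‖x‖ ^ 2) ^ (-a / 2) * weight a x = 1 := by
  unfold weight
  rw [one_pow, ← Real.rpow_add (by positivity), show -a / 2 + a / 2 = 0 by ring, Real.rpow_zero]

lemma weightedNorm_nonneg (a : ℝ) (φ : Space n → ℝ) : 0 ≤ weightedNorm 1 a φ :=
  Real.iSup_nonneg fun x => by positivity

lemma weighted_le {a C : ℝ} {φ : Space n → ℝ} {x : Space n} (h : |φ x| ≤ C * weight a x) :
    (1 ^ 2 + ‖x‖ ^ 2) ^ (-a / 2) * |φ x| ≤ C := by
  calc (1 ^ 2 + ‖x‖ ^ 2) ^ (-a / 2) * |φ x|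
      ≤ (1 ^ 2 + ‖x‖ ^ 2) ^ (-a / 2) * (C * weight a x) := by gcongr
    _ = C * ((1 ^ 2 + ‖x‖ ^ 2) ^ (-a / 2) * weight a x) := by ring
    _ = C := by rw [rpow_neg_mul_weight, mul_one]

lemma weightedNorm_le {a C : ℝ} {φ : Space n → ℝ} (h : ∀ x, |φ x| ≤ C * weight a x) :
    weightedNorm 1 a φ ≤ C := ciSup_le fun x => weighted_le (h x)

/-- The a priori bound C is essential: the supremum of an unbounded set of reals is 0 by convention.
-/
lemma abs_le_weightedNorm {a C : ℝ} {φ : Space n → ℝ} (h : ∀ x, |φ x| ≤ C * weight a x)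
    (x : Space n) : |φ x| ≤ weightedNorm 1 a φ * weight a x := by
  have hb : BddAbove (Set.range fun x => (1 ^ 2 + ‖x‖ ^ 2) ^ (-a / 2) * |φ x|) :=
    ⟨C, by rintro _ ⟨y, rfl⟩; exact weighted_le (h y)⟩
  have h1 := le_ciSup hb x
  calc |φ x| = ((1 ^ 2 + ‖x‖ ^ 2) ^ (-a / 2) * weight a x) * |φ x| := by
        rw [rpow_neg_mul_weight, one_mul]
    _ = ((1 ^ 2 + ‖x‖ ^ 2) ^ (-a / 2) * |φ x|) * weight a x := by ring
    _ ≤ _ := mul_le_mul_of_nonneg_right h1 (weight_pos a x).le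

lemma eventually_one_le_norm : ∀ᶠ x in cocompact (Space n), 1 ≤ ‖x‖ :=
  (tendsto_norm_cocompact_atTop (E := Space n)).eventually_ge_atTop 1

lemma mem_BC {a C : ℝ} (ha : 0 ≤ a) {φ : Space n → ℝ} (hφ : Continuous φ)
    (h : ∀ x, |φ x| ≤ C * weight a x) : φ ∈ BC n a := by
  refine ⟨hφ, IsBigO.of_bound (C * 2 ^ (a / 2)) ?_⟩
  filter_upwards [eventually_one_le_norm] with x hx
  have hC : 0 ≤ C := nonneg_of_mul_nonneg_left ((abs_nonneg _).trans (h 0)) (weight_pos a 0)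
  have hw : weight a x ≤ 2 ^ (a / 2) * ‖x‖ ^ a := by
    have h1 : ‖x‖ ^ a = (‖x‖ ^ 2) ^ (a / 2) := by
      rw [← Real.rpow_natCast, ← Real.rpow_mul (norm_nonneg _)]
      congr 1; push_cast; ring
    rw [h1, ← Real.mul_rpow (by positivity) (by positivity)]
    exact Real.rpow_le_rpow (by positivity) (by nlinarith) (by positivity)
  rw [Real.norm_eq_abs, Real.norm_eq_abs, abs_of_nonneg (by positivity : 0 ≤ ‖x‖ ^ a), mul_assoc]
  exact (h x).trans (mul_le_mul_of_nonneg_left hw hC)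

lemma exists_le_weight_of_mem_BC {a : ℝ} (ha : 0 ≤ a) {φ : Space n → ℝ} (hφ : φ ∈ BC n a) :
    ∃ C, ∀ x, |φ x| ≤ C * weight a x := by
  obtain ⟨hc, hO⟩ := hφ
  obtain ⟨C, hC, h⟩ := hO.exists_nonneg
  rw [IsBigOWith_def] at h
  obtain ⟨S, hS, hSC⟩ := mem_cocompact.1 h
  obtain ⟨D, hD⟩ := hS.exists_bound_of_continuousOn hc.continuousOn
  refine ⟨max C D, fun x => ?_⟩
  have hw := weight_pos a x
  by_cases hx : x ∈ S
  · calc |φ x| ≤ D * 1 := by rw [mul_one]; exact hD x hx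
      _ ≤ max C D * weight a x := mul_le_mul (le_max_right _ _) (one_le_weight ha x) zero_le_one
          (hC.trans (le_max_left _ _))
  · have h1 : ‖φ x‖ ≤ C * ‖‖x‖ ^ a‖ := hSC hx
    rw [Real.norm_eq_abs, Real.norm_eq_abs, abs_of_nonneg (by positivity : 0 ≤ ‖x‖ ^ a)] at h1
    exact h1.trans (mul_le_mul (le_max_left _ _) (norm_rpow_le_weight ha le_rfl x) (by positivity)
      (hC.trans (le_max_left _ _)))

/-- Near each time the weighted norm changes by less than 1; compactness of [0,T] makes the bound
uniform. -/
lemma exists_le_weight_of_mem_ZInfty {a : ℝ} (ha : 0 ≤ a) {u : Space n → ℝ → ℝ}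
    (hu : u ∈ ZInfty n a) (T : ℝ) :
    ∃ A, ∀ y τ, 0 ≤ τ → τ ≤ T → |u y τ| ≤ A * weight a y := by
  obtain ⟨hBC, hcont⟩ := hu
  have hK : IsCompact (Set.Icc 0 T) := isCompact_Icc
  have : ∃ A, ∀ y, ∀ τ ∈ Set.Icc 0 T, |u y τ| ≤ A * weight a y := by
    refine hK.induction_on (p := fun s => ∃ A, ∀ y, ∀ τ ∈ s, |u y τ| ≤ A * weight a y)
      ⟨0, by simp⟩ ?_ ?_ ?_
    · rintro s t hst ⟨A, hA⟩
      exact ⟨A, fun y τ hτ => hA y τ (hst hτ)⟩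
    · rintro s t ⟨A, hA⟩ ⟨B, hB⟩
      refine ⟨max A B, fun y τ hτ => ?_⟩
      have hw := (weight_pos a y).le
      rcases hτ with hτ | hτ
      · exact (hA y τ hτ).trans (mul_le_mul_of_nonneg_right (le_max_left _ _) hw)
      · exact (hB y τ hτ).trans (mul_le_mul_of_nonneg_right (le_max_right _ _) hw)
    · intro t ht
      obtain ⟨C, hC⟩ := exists_le_weight_of_mem_BC ha (hBC t ht.1)
      have hev : ∀ᶠ s in 𝓝[Set.Icc 0 T] t, weightedNorm 1 a (fun x => u x s - u x t) < 1 :=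
        ((hcont t ht.1).mono_left (nhdsWithin_mono t fun s hs => hs.1)).eventually
          (gt_mem_nhds one_pos)
      refine ⟨_, inter_mem hev self_mem_nhdsWithin, 1 + C, fun y s hs => ?_⟩
      obtain ⟨D, hD⟩ := exists_le_weight_of_mem_BC ha (hBC s hs.2.1)
      have h1 := abs_le_weightedNorm (φ := fun x => u x s - u x t) (C := D + C) (fun x => by
        rw [add_mul]
        exact (abs_sub _ _).trans (add_le_add (hD x) (hC x))) y
      have h2 : |u y s - u y t| ≤ 1 * weight a y :=
        h1.trans (mul_le_mul_of_nonneg_right (le_of_lt hs.1) (weight_pos a y).le)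
      calc |u y s| = |(u y s - u y t) + u y t| := by ring_nf
        _ ≤ |u y s - u y t| + |u y t| := abs_add_le _ _
        _ ≤ 1 * weight a y + C * weight a y := add_le_add h2 (hC y)
        _ = _ := by ring
  obtain ⟨A, hA⟩ := this
  exact ⟨A, fun y τ h1 h2 => hA y τ ⟨h1, h2⟩⟩

lemma exp_neg_mul_mem_ZInfty {a K : ℝ} (ha : 0 ≤ a) {μ : Space n → ℝ → ℝ} {M m : ℝ → ℝ}
    (hM : Continuous M) (hm : Continuous m) (hμc : ∀ t, 0 ≤ t → Continuous fun x => μ x t)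
    (hb : ∀ x t, 0 ≤ t → |μ x t| ≤ M t * weight a x)
    (hinc : ∀ x s t, 0 ≤ s → 0 ≤ t → |μ x t - μ x s| ≤ |∫ τ in s..t, m τ| * (K * weight a x)) :
    (fun x t => Real.exp (-t) * μ x t) ∈ ZInfty n a := by
  constructor
  · intro t ht
    refine mem_BC (C := Real.exp (-t) * M t) ha (continuous_const.mul (hμc t ht)) fun x => ?_
    rw [abs_mul, abs_of_pos (Real.exp_pos _), mul_assoc]
    exact mul_le_mul_of_nonneg_left (hb x t ht) (Real.exp_pos _).le
  · intro t ht
    let G : ℝ → ℝ := fun s => |Real.exp (-s) - Real.exp (-t)| * M s +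
      Real.exp (-t) * (|∫ τ in t..s, m τ| * K)
    have hint : Continuous fun s => ∫ τ in t..s, m τ :=
      intervalIntegral.continuous_primitive (fun _ _ => hm.intervalIntegrable _ _) t
    have hG : Continuous G := by fun_prop
    have hG0 : Tendsto G (𝓝[Set.Ici 0] t) (𝓝 0) := by
      have := (hG.tendsto t).mono_left (nhdsWithin_le_nhds (s := Set.Ici 0))
      simpa [G] using this
    refine tendsto_of_tendsto_of_tendsto_of_le_of_le' tendsto_const_nhds hG0
      (Eventually.of_forall fun s => weightedNorm_nonneg _ _) ?_
    filter_upwards [self_mem_nhdsWithin] with s hs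
    refine weightedNorm_le fun x => ?_
    calc |Real.exp (-s) * μ x s - Real.exp (-t) * μ x t|
        = |(Real.exp (-s) - Real.exp (-t)) * μ x s + Real.exp (-t) * (μ x s - μ x t)| := by
          ring_nf
      _ ≤ |Real.exp (-s) - Real.exp (-t)| * |μ x s| + Real.exp (-t) * |μ x s - μ x t| := by
          refine (abs_add_le _ _).trans (le_of_eq ?_)
          rw [abs_mul, abs_mul, abs_of_pos (Real.exp_pos (-t))]
      _ ≤ |Real.exp (-s) - Real.exp (-t)| * (M s * weight a x) +
            Real.exp (-t) * (|∫ τ in t..s, m τ| * (K * weight a x)) := by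
          gcongr
          · exact hb x s hs
          · exact hinc x t s ht hs
      _ = G s * weight a x := by simp only [G]; ring

/-! ### The maximal solution -/

section

variable {p σ a : ℝ} {Λ : ℝ → ℝ} {V : Space n → ℝ → ℝ}

/-- The maximal solution `e^{-t} μ`, with `μ` the limit of the monotone iteration. -/
def maximalSolution (p a : ℝ) (Λ : ℝ → ℝ) (V : Space n → ℝ → ℝ) (x : Space n) (t : ℝ) : ℝ :=
  Real.exp (-t) * iterateLimit p a Λ V x t

lemma exp_mul_maximalSolution (x : Space n) (t : ℝ) :
    Real.exp t * maximalSolution p a Λ V x t = iterateLimit p a Λ V x t := by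
  rw [maximalSolution, ← mul_assoc, ← Real.exp_add, add_neg_cancel, Real.exp_zero, one_mul]

theorem isSSolution_maximalSolution (hp0 : 0 < p) (hp1 : p < 1) (hσ : 0 ≤ σ)
    (ha : σ / (1 - p) ≤ a) (hV : PowerBound σ Λ V) :
    IsSSolution p a (fun _ => 0) V (maximalSolution p a Λ V) := by
  have ha0 := nonneg_of_div_le hp1 hσ ha
  have hMc := continuous_barrier (n := n) (p := p) (a := a) hV
  have hM1 : ∀ τ, 0 < τ → 1 ≤ barrier n p a Λ τ := fun τ hτ => one_le_barrier hV hτ.le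
  have hG := timeGrowth_iterateLimit (n := n) hp0 hp1 hσ ha hV
  have hGs := hG.source hp0 hp1 hσ ha hV hM1
  have hsc := continuous_sourceCoeff (p := p) hV hMc
  have heq : ∀ x t, 0 ≤ t → iterateLimit p a Λ V x t =
      timePotential (iterateLimit p a Λ V) x t +
        timePotential (source p V (iterateLimit p a Λ V)) x t := fun x t ht => by
    rw [← Ms_eq, ← iterateLimit_eq_Ms hp0 hp1 hσ ha hV x ht]
  have hnn : ∀ x t, 0 ≤ t → 0 ≤ iterateLimit p a Λ V x t := fun x t ht =>
    ge_of_tendsto' (tendsto_iterate_of_nonneg hp0 hp1 hσ ha hV x ht) fun k =>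
      ((iterate_props hp0 hp1 hσ ha hV k).2 x t ht).1
  refine ⟨?_, fun x t ht => mul_nonneg (Real.exp_pos _).le (hnn x t ht), fun x t ht => ?_⟩
  · refine exp_neg_mul_mem_ZInfty (K := besselConst n a) ha0 hMc
      (m := fun τ => barrier n p a Λ τ + Real.exp ((1 - p) * τ) * Λ τ * barrier n p a Λ τ)
      (hMc.add hsc) ?_ ?_ ?_
    · intro t ht
      -- The limit is so far only measurable in x. The fixed point equation writes it as time
      -- integrals of potentials, which are continuous.
      simp_rw [heq _ t ht]
      exact (hG.continuous_timePotential ha0 hMc ht).add (hGs.continuous_timePotential ha0 hsc ht)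
    · intro x t ht
      rw [abs_of_nonneg (hnn x t ht)]
      exact le_of_tendsto' (tendsto_iterate_of_nonneg hp0 hp1 hσ ha hV x ht) fun k =>
        ((iterate_props hp0 hp1 hσ ha hV k).2 x t ht).2
    · have main : ∀ x s t, 0 ≤ s → s ≤ t →
          |iterateLimit p a Λ V x t - iterateLimit p a Λ V x s| ≤
          |∫ τ in s..t, (barrier n p a Λ τ + Real.exp ((1 - p) * τ) * Λ τ * barrier n p a Λ τ)| *
            (besselConst n a * weight a x) := by
        intro x s t hs hst
        have ht := hs.trans hst
        have hΛ := hV.coeff_nonneg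
        have hM0 := fun τ => (barrier_pos (n := n) (p := p) (a := a) (Λ := Λ) τ).le
        have i1 : 0 ≤ ∫ τ in s..t, barrier n p a Λ τ :=
          intervalIntegral.integral_nonneg hst fun τ _ => hM0 τ
        have i2 : 0 ≤ ∫ τ in s..t, Real.exp ((1 - p) * τ) * Λ τ * barrier n p a Λ τ :=
          intervalIntegral.integral_nonneg hst fun τ _ =>
            mul_nonneg (mul_nonneg (Real.exp_pos _).le (hΛ τ)) (hM0 τ)
        have h1 := hG.abs_timePotential_sub_le ha0 hMc x hs ht
        have h2 := hGs.abs_timePotential_sub_le ha0 hsc x hs ht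
        rw [intervalIntegral.integral_add (hMc.intervalIntegrable _ _)
          (hsc.intervalIntegrable _ _), abs_of_nonneg (add_nonneg i1 i2), add_mul, heq x t ht,
          heq x s hs, add_sub_add_comm]
        rw [abs_of_nonneg i1] at h1
        rw [abs_of_nonneg i2] at h2
        exact (abs_add_le _ _).trans (add_le_add h1 h2)
      intro x s t hs ht
      rcases le_total s t with h | h
      · exact main x s t hs h
      · rw [abs_sub_comm, intervalIntegral.integral_symm, abs_neg]
        exact main x t s ht h
  · simp_rw [exp_mul_maximalSolution]
    exact iterateLimit_eq_Ms hp0 hp1 hσ ha hV x ht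

/-- Every subsolution of polynomial growth lies below the maximal solution. -/
theorem le_maximalSolution (hp0 : 0 < p) (hp1 : p < 1) (hσ : 0 ≤ σ) (ha : σ / (1 - p) ≤ a)
    (hV : PowerBound σ Λ V) {v : Space n → ℝ → ℝ} (h0 : ∀ y τ, 0 ≤ τ → 0 ≤ v y τ)
    (h : ∀ y τ, 0 ≤ τ → Real.exp τ * v y τ ≤
      Ms p (fun _ => 0) V (fun y s => Real.exp s * v y s) y τ)
    (hb : ∀ T, ∃ A, ∀ y τ, 0 ≤ τ → τ ≤ T → v y τ ≤ A * weight a y) (x : Space n) {t : ℝ}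
    (ht : 0 ≤ t) : v x t ≤ maximalSolution p a Λ V x t := by
  refine le_of_mul_le_mul_left ?_ (Real.exp_pos t)
  rw [exp_mul_maximalSolution]
  refine ge_of_tendsto' (tendsto_iterate_of_nonneg hp0 hp1 hσ ha hV x ht) fun k =>
    le_iterate_of_le_Ms (μ := fun y s => Real.exp s * v y s) hp0 hp1 hσ ha hV
      (fun y τ hτ => mul_nonneg (Real.exp_pos _).le (h0 y τ hτ)) h (fun T => ?_) k x t ht
  obtain ⟨A, hA⟩ := hb T
  refine ⟨Real.exp T * A, fun y τ h1 h2 => ?_⟩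
  rw [mul_assoc]
  exact mul_le_mul (Real.exp_le_exp.2 h2) (hA y τ h1 h2) (h0 y τ h1) (Real.exp_pos _).le

theorem isMaximalSSolution_maximalSolution (hp0 : 0 < p) (hp1 : p < 1) (hσ : 0 ≤ σ)
    (ha : σ / (1 - p) ≤ a) (hV : PowerBound σ Λ V) :
    IsMaximalSSolution p a V (maximalSolution p a Λ V) where
  isSSolution := isSSolution_maximalSolution hp0 hp1 hσ ha hV
  le v hv x t ht := by
    refine le_maximalSolution hp0 hp1 hσ ha hV hv.nonneg (fun y τ hτ => (hv.eq y τ hτ).le)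
      (fun T => ?_) x ht
    obtain ⟨A, hA⟩ := exists_le_weight_of_mem_ZInfty (nonneg_of_div_le hp1 hσ ha) hv.mem T
    exact ⟨A, fun y τ h1 h2 => (le_abs_self _).trans (hA y τ h1 h2)⟩

/-- Potentials that agree at positive times have the same s-solutions. -/
lemma IsSSolution.congr {u₀ : Space n → ℝ} {V' u : Space n → ℝ → ℝ}
    (h : ∀ y τ, 0 < τ → V y τ = V' y τ) (hu : IsSSolution p a u₀ V u) :
    IsSSolution p a u₀ V' u :=
  ⟨hu.mem, hu.nonneg, fun x t ht => by rw [hu.eq x t ht, Ms_congr h _ x ht]⟩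

lemma IsMaximalSSolution.congr {V' u : Space n → ℝ → ℝ}
    (h : ∀ y τ, 0 < τ → V y τ = V' y τ) (hu : IsMaximalSSolution p a V u) :
    IsMaximalSSolution p a V' u :=
  ⟨hu.isSSolution.congr h, fun v hv => hu.le v (hv.congr fun y τ hτ => (h y τ hτ).symm)⟩

end

/-! ### The lower bound for the maximal solution -/

section

variable {p σ a ϑ ε₀ : ℝ} {Λ L : ℝ → ℝ} {V : Space n → ℝ → ℝ}

/-- For n = 1 the set is {0} ∪ [1,∞), so moving up from 0 may leave it. The last hypothesis rules
this out. -/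
lemma JPlus_mono {s t : ℝ} (hs : s ∈ JPlus n) (h : s ≤ t) (ht : s = 0 → t = 0) : t ∈ JPlus n := by
  obtain ⟨h0, h1⟩ := hs
  refine ⟨h0.trans h, ?_⟩
  rcases h0.eq_or_lt with h2 | h2
  · rw [ht h2.symm, zero_mul]
  · have := nonneg_of_mul_nonneg_right h1 h2
    exact mul_nonneg (h0.trans h) (by linarith)

/-- The separated function `g^{1/(1-p)} |x|^{σ/(1-p)}`, with `g' = (1-p) ε₀ ϑ L`, is a
subsolution. -/
lemma separated_le_Ms (hn : 1 ≤ n) (hp0 : 0 < p) (hp1 : p < 1) (hσ : σ ∈ JPlus n)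
    (ha : σ / (1 - p) ≤ a) (hV : PowerBound σ Λ V) (hϑ : 0 ≤ ϑ) (hε : 0 ≤ ε₀)
    (hL : Continuous L) (hL0 : ∀ t, 0 ≤ L t)
    (hE : BesselLowerEstimate σ ϑ L V ε₀ (σ * p / (1 - p))) (x : Space n) {t : ℝ} (ht : 0 ≤ t) :
    Real.exp t * ((ε₀ * ϑ * (1 - p) * ∫ s in (0 : ℝ)..t, L s) ^ (1 / (1 - p)) *
        ‖x‖ ^ (σ / (1 - p))) ≤
      Ms p (fun _ => 0) V (fun y τ => Real.exp τ *
        ((ε₀ * ϑ * (1 - p) * ∫ s in (0 : ℝ)..τ, L s) ^ (1 / (1 - p)) * ‖y‖ ^ (σ / (1 - p)))) x t := by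
  have hq0 : 0 < 1 - p := by linarith
  have ha0 := nonneg_of_div_le hp1 hσ.1 ha
  set q := 1 / (1 - p) with hq
  set s := σ / (1 - p) with hs
  have hs0 : 0 ≤ s := div_nonneg hσ.1 hq0.le
  have hq1 : 1 ≤ q := by rw [hq, le_div_iff₀ hq0]; linarith
  have hqp : q - 1 = q * p := by rw [hq]; field_simp; ring
  have hsp : s * p = σ * p / (1 - p) := by rw [hs]; ring
  have hsd : σ + σ * p / (1 - p) = s := by rw [hs]; field_simp; ring
  have hsJ : s ∈ JPlus n := JPlus_mono hσ
    (by rw [hs, le_div_iff₀ hq0]; nlinarith [hσ.1]) (fun h => by rw [hs, h, zero_div])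
  set g : ℝ → ℝ := fun τ => ε₀ * ϑ * (1 - p) * ∫ s in (0 : ℝ)..τ, L s with hg
  have hgd : ∀ τ, HasDerivAt g (ε₀ * ϑ * (1 - p) * L τ) τ := fun τ =>
    ((hL.integral_hasStrictDerivAt 0 τ).hasDerivAt).const_mul _
  have hgc : Continuous g := continuous_iff_continuousAt.2 fun τ => (hgd τ).continuousAt
  have hg0 : ∀ τ, 0 ≤ τ → 0 ≤ g τ := fun τ hτ => mul_nonneg (by positivity)
    (intervalIntegral.integral_nonneg hτ fun r _ => hL0 r)
  have hgq : ∀ r : ℝ, 0 ≤ r → Continuous fun τ => g τ ^ r := fun r hr =>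
    hgc.rpow_const fun _ => Or.inr hr
  set μ : Space n → ℝ → ℝ := fun y τ => Real.exp τ * (g τ ^ q * ‖y‖ ^ s) with hμ
  change μ x t ≤ Ms p (fun _ => 0) V μ x t
  -- The summand 1 keeps the coefficient at least 1, as the bound on the source requires.
  have hm : Continuous fun τ => 1 + Real.exp τ * |g τ ^ q| := by
    have := (hgq q (by linarith)).abs
    fun_prop
  have hm1 : ∀ τ : ℝ, 0 < τ → 1 ≤ 1 + Real.exp τ * |g τ ^ q| := fun τ _ => by
    have : 0 ≤ Real.exp τ * |g τ ^ q| := by positivity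
    linarith
  have hG : TimeGrowth a (fun τ => 1 + Real.exp τ * |g τ ^ q|) μ := by
    refine ⟨?_, fun y τ hτ => ?_, fun y τ hτ => ?_⟩
    · have h1 := (hgq q (by linarith)).measurable
      have h2 := (continuous_norm_rpow (n := n) hs0).measurable
      unfold Function.uncurry
      simp only [hμ]
      fun_prop
    · have := hg0 τ hτ.le
      simp only [hμ]
      positivity
    · have h1 := norm_rpow_le_weight hs0 ha y
      have h2 : 0 ≤ g τ ^ q := Real.rpow_nonneg (hg0 τ hτ.le) q
      have h3 := weight_pos a y
      simp only [hμ]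
      rw [abs_of_nonneg h2, add_mul, one_mul, ← mul_assoc]
      have h4 : Real.exp τ * g τ ^ q * ‖y‖ ^ s ≤ Real.exp τ * g τ ^ q * weight a y := by gcongr
      linarith
  have hGs := hG.source hp0 hp1 hσ.1 ha hV hm1
  have hi1 := hG.intervalIntegrable ha0 hm x le_rfl ht
  have hi2 := hGs.intervalIntegrable ha0 (continuous_sourceCoeff hV hm) x le_rfl ht
  have hB1 : ∀ τ, 0 < τ → Real.exp τ * g τ ^ q * ‖x‖ ^ s ≤ besselPotential (fun y => μ y τ) x := by
    intro τ hτ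
    simp only [hμ, ← mul_assoc]
    rw [besselPotential_const_mul]
    exact mul_le_mul_of_nonneg_left (norm_rpow_le_besselPotential hn hsJ x)
      (mul_nonneg (Real.exp_pos _).le (Real.rpow_nonneg (hg0 τ hτ.le) q))
  -- In the source, e^{(1-p)τ}(e^τ)^p = e^τ, and the power of |y| becomes d = σp/(1-p), so (E_d)
  -- gives exponent σ + d = s.
  have hB2 : ∀ τ, 0 < τ → Real.exp τ * (ε₀ * ϑ * L τ * g τ ^ (q * p)) * ‖x‖ ^ s ≤
      besselPotential (fun y => source p V μ y τ) x := by
    intro τ hτ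
    have hgτ := hg0 τ hτ.le
    have h1 : (fun y => source p V μ y τ) = fun y =>
        Real.exp τ * g τ ^ (q * p) * (V y τ * ‖y‖ ^ (σ * p / (1 - p))) := by
      ext y
      simp only [source, hμ]
      rw [Real.mul_rpow (Real.exp_pos _).le (by positivity), Real.mul_rpow (by positivity)
        (by positivity), ← Real.exp_mul, ← Real.rpow_mul hgτ, ← Real.rpow_mul (norm_nonneg _), hsp]
      have h2 : Real.exp τ = Real.exp ((1 - p) * τ) * Real.exp (τ * p) := by
        rw [← Real.exp_add]; congr 1; ring
      rw [h2]; ring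
    rw [h1, besselPotential_const_mul]
    have h3 := hE x τ hτ
    rw [hsd] at h3
    have h4 : 0 ≤ Real.exp τ * g τ ^ (q * p) :=
      mul_nonneg (Real.exp_pos _).le (Real.rpow_nonneg hgτ _)
    calc _ = Real.exp τ * g τ ^ (q * p) * (ε₀ * (ϑ * L τ) * ‖x‖ ^ s) := by ring
      _ ≤ _ := mul_le_mul_of_nonneg_left h3 h4
  -- As q(1-p) = 1 and q - 1 = qp, the derivative of g^q is ε₀ϑL·g^{qp}, exactly the lower bound for
  -- the source.
  have hderiv : ∀ τ, HasDerivAt (fun τ => Real.exp τ * g τ ^ q)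
      (Real.exp τ * g τ ^ q + Real.exp τ * (ε₀ * ϑ * L τ * g τ ^ (q * p))) τ := by
    intro τ
    have h1 := (Real.hasDerivAt_exp τ).mul ((hgd τ).rpow_const (Or.inr hq1))
    convert! h1 using 1
    rw [hqp]
    have : q * (1 - p) = 1 := by rw [hq]; field_simp
    linear_combination (-(Real.exp τ * ε₀ * ϑ * L τ * g τ ^ (q * p))) * this
  have hc1 : Continuous fun τ => Real.exp τ * g τ ^ q :=
    Real.continuous_exp.mul (hgq q (by linarith))
  have hc2 : Continuous fun τ => Real.exp τ * (ε₀ * ϑ * L τ * g τ ^ (q * p)) :=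
    Real.continuous_exp.mul ((continuous_const.mul hL).mul (hgq (q * p) (by positivity)))
  -- The boundary term at 0 vanishes since g(0) = 0 and q ≠ 0.
  have hftc : ∫ τ in (0 : ℝ)..t, (Real.exp τ * g τ ^ q +
      Real.exp τ * (ε₀ * ϑ * L τ * g τ ^ (q * p))) = Real.exp t * g t ^ q := by
    rw [intervalIntegral.integral_eq_sub_of_hasDerivAt (fun τ _ => hderiv τ)
      ((hc1.add hc2).intervalIntegrable _ _)]
    simp [hg, Real.zero_rpow (show q ≠ 0 by linarith)]
  rw [Ms_eq]
  calc μ x t = (∫ τ in (0 : ℝ)..t, Real.exp τ * g τ ^ q * ‖x‖ ^ s) +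
        ∫ τ in (0 : ℝ)..t, Real.exp τ * (ε₀ * ϑ * L τ * g τ ^ (q * p)) * ‖x‖ ^ s := by
        rw [intervalIntegral.integral_mul_const, intervalIntegral.integral_mul_const, ← add_mul,
          ← intervalIntegral.integral_add (hc1.intervalIntegrable _ _)
            (hc2.intervalIntegrable _ _), hftc]
        simp only [hμ]; ring
    _ ≤ _ := by
        refine add_le_add ?_ ?_
        · exact intervalIntegral.integral_mono_on_of_le_Ioo ht
            ((hc1.mul continuous_const).intervalIntegrable _ _) hi1 fun τ hτ => hB1 τ hτ.1
        · exact intervalIntegral.integral_mono_on_of_le_Ioo ht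
            ((hc2.mul continuous_const).intervalIntegrable _ _) hi2 fun τ hτ => hB2 τ hτ.1

/-- The separated subsolution need not be checked to lie in `ZInfty`: comparison with the maximal
solution asks only for a growth bound on [0,T], and monotonicity of g provides it. -/
theorem rpow_le_maximalSolution (hn : 1 ≤ n) (hp0 : 0 < p) (hp1 : p < 1) (hσ : σ ∈ JPlus n)
    (ha : σ / (1 - p) ≤ a) (hV : PowerBound σ Λ V) (hϑ : 0 ≤ ϑ) (hε : 0 ≤ ε₀)
    (hL : Continuous L) (hL0 : ∀ t, 0 ≤ L t)
    (hE : BesselLowerEstimate σ ϑ L V ε₀ (σ * p / (1 - p))) (x : Space n) {t : ℝ} (ht : 0 ≤ t) :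
    (ε₀ * ϑ * (1 - p) * ‖x‖ ^ σ * ∫ s in (0 : ℝ)..t, L s) ^ (1 / (1 - p)) ≤
      maximalSolution p a Λ V x t := by
  have hq0 : 0 < 1 - p := by linarith
  set g : ℝ → ℝ := fun τ => ε₀ * ϑ * (1 - p) * ∫ s in (0 : ℝ)..τ, L s with hg
  have hg0 : ∀ τ, 0 ≤ τ → 0 ≤ g τ := fun τ hτ => mul_nonneg (by positivity)
    (intervalIntegral.integral_nonneg hτ fun r _ => hL0 r)
  have hgm : ∀ τ T, 0 ≤ τ → τ ≤ T → g τ ≤ g T := fun τ T h1 h2 =>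
    mul_le_mul_of_nonneg_left (intervalIntegral.integral_mono_interval le_rfl h1 h2
      (ae_of_all _ fun r => hL0 r) (hL.intervalIntegrable _ _)) (by positivity)
  have heq : (ε₀ * ϑ * (1 - p) * ‖x‖ ^ σ * ∫ s in (0 : ℝ)..t, L s) ^ (1 / (1 - p)) =
      g t ^ (1 / (1 - p)) * ‖x‖ ^ (σ / (1 - p)) := by
    rw [show ε₀ * ϑ * (1 - p) * ‖x‖ ^ σ * ∫ s in (0 : ℝ)..t, L s = g t * ‖x‖ ^ σ by
      simp only [hg]; ring, Real.mul_rpow (hg0 t ht) (by positivity),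
      ← Real.rpow_mul (norm_nonneg _), mul_one_div]
  rw [heq]
  refine le_maximalSolution (v := fun y τ => g τ ^ (1 / (1 - p)) * ‖y‖ ^ (σ / (1 - p)))
    hp0 hp1 hσ.1 ha hV (fun y τ hτ => ?_)
    (fun y τ hτ => separated_le_Ms hn hp0 hp1 hσ ha hV hϑ hε hL hL0 hE y hτ) (fun T => ?_) x ht
  · have := hg0 τ hτ
    positivity
  · refine ⟨g T ^ (1 / (1 - p)), fun y τ h1 h2 => ?_⟩
    exact mul_le_mul (Real.rpow_le_rpow (hg0 τ h1) (hgm τ T h1 h2) (by positivity))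
      (norm_rpow_le_weight (div_nonneg hσ.1 hq0.le) ha y) (by positivity)
      (Real.rpow_nonneg (hg0 T (h1.trans h2)) _)

end

end Pseudoparabolic

end

/-! ### Normalization of the data and assembly of the theorem. -/

theorem mainTheorem6 (n : ℕ) (hn : 1 ≤ n)
    (σ ϑl ϑu : ℝ) (hσ : σ ∈ Pseudoparabolic.JPlus n) (hϑl : 0 < ϑl) (hϑu : 0 < ϑu)
    (L : ℝ → ℝ) (hLcont : ContinuousOn L (Set.Ici 0)) (hLpos : ∀ t, 0 < t → 0 < L t)
    (V : Pseudoparabolic.Space n → ℝ → ℝ)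
    (hVcont : ContinuousOn (Function.uncurry V) (Set.univ ×ˢ Set.Ioi 0))
    (hVnonneg : ∀ x t, 0 < t → 0 ≤ V x t)
    (hVlower : ∀ x t, 1 ≤ ‖x‖ → 0 < t → ϑl * L t * ‖x‖ ^ σ ≤ V x t)
    (hVupper : ∀ x t, 0 < t → V x t ≤ ϑu * L t * ‖x‖ ^ σ) :
    (∃ ε₀ : ℝ, 0 < ε₀ ∧
      ∀ d : ℝ, 0 ≤ d → Pseudoparabolic.BesselLowerEstimate σ ϑl L V ε₀ d) ∧
    ∀ ε₀ p a : ℝ, 0 < ε₀ → 0 < p → p < 1 →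
      (∀ d : ℝ, 0 ≤ d → d ≤ σ * p / (1 - p) →
        Pseudoparabolic.BesselLowerEstimate σ ϑl L V ε₀ d) →
      p < ε₀ * (ϑl / ϑu) →
      σ / (1 - p) ≤ a →
      ∃ u : Pseudoparabolic.Space n → ℝ → ℝ,
        Pseudoparabolic.IsMaximalSSolution p a V u ∧
        (∀ v, Pseudoparabolic.IsMaximalSSolution p a V v → ∀ x t, 0 ≤ t → v x t = u x t) ∧
        ∀ x t, 0 ≤ t →
          (ε₀ * ϑl * (1 - p) * ‖x‖ ^ σ * ∫ s in (0 : ℝ)..t, L s) ^ (1 / (1 - p)) ≤ u x t := by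
  refine ⟨Pseudoparabolic.exists_besselLowerEstimate hn hσ.1 hϑl hLpos hVcont hVnonneg hVlower
    hVupper, ?_⟩
  intro ε₀ p a hε hp0 hp1 hE _ ha
  -- A continuous nonnegative function on all of ℝ that agrees with L at positive times, the only
  -- times that matter to the integrals.
  let L' : ℝ → ℝ := fun t => max (L (max t 0)) 0
  have hL'c : Continuous L' := (hLcont.comp_continuous (f := fun t => max t 0) (by fun_prop)
    fun t => le_max_right t 0).max continuous_const
  have hL'0 : ∀ t, 0 ≤ L' t := fun t => le_max_right _ _
  have hL'eq : ∀ t, 0 < t → L' t = L t := fun t ht => by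
    simp only [L', max_eq_left ht.le, max_eq_left (hLpos t ht).le]
  let S : Set (Pseudoparabolic.Space n × ℝ) := Set.univ ×ˢ Set.Ioi 0
  have hS : MeasurableSet S := MeasurableSet.univ.prod measurableSet_Ioi
  classical
  -- V is controlled only for t > 0. Setting it to 0 elsewhere gives joint measurability and leaves
  -- the s-solutions unchanged.
  let V' : Pseudoparabolic.Space n → ℝ → ℝ :=
    Function.curry (S.piecewise (Function.uncurry V) fun _ => 0)
  have hV'eq : ∀ y τ, 0 < τ → V' y τ = V y τ := fun y τ hτ =>
    Set.piecewise_eq_of_mem S _ _ (show (y, τ) ∈ S from ⟨trivial, hτ⟩)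
  have hV' : Pseudoparabolic.PowerBound σ (fun t => ϑu * L' t) V' := by
    refine ⟨?_, continuous_const.mul hL'c, fun t => mul_nonneg hϑu.le (hL'0 t), ?_, ?_⟩
    · exact hVcont.measurable_piecewise continuousOn_const hS
    · intro x t ht
      rw [hV'eq x t ht]
      exact hVnonneg x t ht
    · intro x t ht
      rw [hV'eq x t ht, hL'eq t ht]
      exact hVupper x t ht
  have hmax := (Pseudoparabolic.isMaximalSSolution_maximalSolution hp0 hp1 hσ.1 ha hV').congr hV'eq
  -- Two maximal solutions dominate each other, hence coincide.
  refine ⟨_, hmax, fun v hv x t ht => le_antisymm (hmax.le v hv.isSSolution x t ht)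
    (hv.le _ hmax.isSSolution x t ht), fun x t ht => ?_⟩
  have hint : ∫ s in (0 : ℝ)..t, L s = ∫ s in (0 : ℝ)..t, L' s :=
    intervalIntegral.integral_congr_ae (Filter.Eventually.of_forall fun s hs =>
      (hL'eq s (Pseudoparabolic.pos_of_mem_uIoc le_rfl ht hs)).symm)
  rw [hint]
  refine Pseudoparabolic.rpow_le_maximalSolution hn hp0 hp1 hσ ha hV' hϑl.le hε.le hL'c hL'0 ?_ x ht
  intro y τ hτ
  simp_rw [hL'eq τ hτ, hV'eq _ τ hτ]
  exact hE _ (div_nonneg (mul_nonneg hσ.1 hp0.le) (by linarith)) le_rfl y τ hτ
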